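/- All vector spaces are over $\mathbb Q$, $(-)^\vee=\mathrm{Hom}(-,\mathbb Q)$, and a graded vector space has finite type if it is finite dimensional in each degree. Let $E=\{E_p\}_{p\ge 0}$ be a graded Lie algebra, and for $n\ge 1$ let $E^n$ be the ideal spanned by the iterated commutators $[x_1,[x_2,\dots,x_n]\dots]$ of length $n$. Call $E$ \emph{pronilpotent} if the canonical map $E\to\varprojlim_n E/E^n$ (the inverse limit being taken degree by degree) is an isomorphism. A \emph{quadratic Sullivan algebra} is a commutative differential graded algebra $(\land W,d)$, where $\land W$ is the free graded commutative algebra on a graded vector space $W=\{W^p\}_{p\ge 1}$, $d$ is a derivation of degree $1$ with $d^2=0$ and $d(W)\subset \land^2W$, and $W=\bigcup_{n\ge 0}W(n)$ with $W(0)=W\cap\ker d$ and $W(n+1)=W\cap d^{-1}(\land W(n))$. A graded Lie algebra $E=\{E_p\}_{p\ge0}$ is \emph{the homotopy Lie algebra} of $(\land W,d)$ if there are linear isomorphisms $s:E_p\stackrel{\cong}{\to}(W^{p+1})^\vee$, $p\ge 0$, such that $$\langle w,s[x,y]\rangle=(-1)^{\deg y+1}\langle dw;sx,sy\rangle$$ for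 all homogeneous $w\in W$, $x,y\in E$, where $\langle v\land w;sx,sy\rangle=\langle v,sy\rangle\langle w,sx\rangle+(-1)^{\deg v\deg w}\langle w,sy\rangle\langle v,sx\rangle$. Suppose that $E$ is pronilpotent and that $E/E^2$ has finite type. Then $E$ is the homotopy Lie algebra of a quadratic Sullivan algebra $\land W$. Moreover this algebra is unique up to isomorphism: if $E$ is also the homotopy Lie algebra of a quadratic Sullivan algebra $\land V$, then there is an isomorphism of commutative differential graded algebras $\land V\cong\land W$ which carries $V$ onto $W$. -/

import Mathlib

open scoped DirectSum

universe u v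

noncomputable section

/-- A graded Lie algebra `E = {E_p}_{p ≥ 0}` over `ℚ`: a bilinear bracket `E_i × E_j → E_{i+j}`
which is graded antisymmetric and satisfies the graded Jacobi identity. The target degree `k` comes
with a proof of `i + j = k`, so that no transport between degrees is needed. -/
class GrLieAlgebra (E : ℕ → Type u) [∀ p, AddCommGroup (E p)] [∀ p, Module ℚ (E p)] where
  bracket : ∀ {i j k : ℕ}, i + j = k → (E i →ₗ[ℚ] E j →ₗ[ℚ] E k)
  antisymm : ∀ {i j k : ℕ} (h : i + j = k) (h' : j + i = k) (x : E i) (y : E j),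
    bracket h x y = -((-1 : ℚ) ^ (i * j) • bracket h' y x)
  jacobi : ∀ {i j k ij jk ik n : ℕ} (hij : i + j = ij) (hjk : j + k = jk) (hik : i + k = ik)
    (h₁ : i + jk = n) (h₂ : ij + k = n) (h₃ : j + ik = n) (x : E i) (y : E j) (z : E k),
    bracket h₁ x (bracket hjk y z) =
      bracket h₂ (bracket hij x y) z + (-1 : ℚ) ^ (i * j) • bracket h₃ y (bracket hik x z)

namespace GrLieAlgebra

variable (E : ℕ → Type u) [∀ p, AddCommGroup (E p)] [∀ p, Module ℚ (E p)] [GrLieAlgebra E]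

/-- The degree `p` part of the ideal `E^n` of the lower central series: `E^1 = E`, and `E^{n+1}` is
the linear span of the brackets `[x, y]` with `x ∈ E` and `y ∈ E^n`, so that `E^n` is the span of
the iterated commutators `[x₁, [x₂, …, xₙ]]` of length `n`. (By convention `E^0 = E`.) -/
def lowerCentral : ℕ → (p : ℕ) → Submodule ℚ (E p)
  | 0, _ => ⊤
  | 1, _ => ⊤
  | n + 2, p => Submodule.span ℚ
      {z | ∃ (i j : ℕ) (h : i + j = p) (x : E i) (y : E j),
        y ∈ lowerCentral (n + 1) j ∧ bracket h x y = z}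

theorem lowerCentral_succ_le : ∀ n p : ℕ, lowerCentral E (n + 1) p ≤ lowerCentral E n p
  | 0, _ => le_top
  | 1, _ => le_top
  | n + 2, p => by
      rw [lowerCentral, lowerCentral]
      refine Submodule.span_mono ?_
      rintro z ⟨i, j, h, x, y, hy, rfl⟩
      exact ⟨i, j, h, x, y, lowerCentral_succ_le (n + 1) j hy, rfl⟩

theorem lowerCentral_anti (p : ℕ) {m n : ℕ} (h : m ≤ n) :
    lowerCentral E n p ≤ lowerCentral E m p :=
  antitone_nat_of_succ_le (f := fun k => lowerCentral E k p)
    (fun k => lowerCentral_succ_le E k p) h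

/-- The degree `p` part of the inverse limit `lim_n E / E^n`. -/
def invLimit (p : ℕ) : Submodule ℚ (∀ n, E p ⧸ lowerCentral E n p) where
  carrier := {a | ∀ (m n : ℕ) (h : m ≤ n),
    Submodule.factor (lowerCentral_anti E p h) (a n) = a m}
  zero_mem' := fun m n h => by simp
  add_mem' := fun {a b} ha hb m n h => by simp [ha m n h, hb m n h]
  smul_mem' := fun c a ha m n h => by simp [ha m n h]

/-- The canonical map `E → lim_n E / E^n` in degree `p`. -/
def toInvLimit (p : ℕ) : E p →ₗ[ℚ] invLimit E p :=
  LinearMap.codRestrict (invLimit E p)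
    (LinearMap.pi fun n => (lowerCentral E n p).mkQ) (fun x m n h => by simp)

/-- `E` is pronilpotent if `E → lim_n E / E^n` is an isomorphism (of graded vector spaces). -/
def IsPronilpotent : Prop := ∀ p, Function.Bijective (toInvLimit E p)

/-- `E / E^2` is a graded vector space of finite type. -/
def AbelianizationFiniteType : Prop := ∀ p, FiniteDimensional ℚ (E p ⧸ lowerCentral E 2 p)

end GrLieAlgebra

section FreeAlgebra

variable (V : ℕ → Type u) [∀ p, AddCommGroup (V p)] [∀ p, Module ℚ (V p)]

/-- The relations `v w = (-1)^{ij} w v`, for `v ∈ V^i`, `w ∈ V^j`, in the tensor algebra of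
`V = ⨁ V^p`. -/
inductive FreeCGA.Rel : TensorAlgebra ℚ (⨁ p, V p) → TensorAlgebra ℚ (⨁ p, V p) → Prop
  | comm {i j : ℕ} (v : V i) (w : V j) : FreeCGA.Rel
      (TensorAlgebra.ι ℚ (DirectSum.lof ℚ ℕ V i v) * TensorAlgebra.ι ℚ (DirectSum.lof ℚ ℕ V j w))
      ((-1 : ℚ) ^ (i * j) •
        (TensorAlgebra.ι ℚ (DirectSum.lof ℚ ℕ V j w) *
          TensorAlgebra.ι ℚ (DirectSum.lof ℚ ℕ V i v)))

/-- The free graded commutative algebra `ΛV` on the graded vector space `V = {V^p}_{p ≥ 0}`. -/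
def FreeCGA : Type u := RingQuot (FreeCGA.Rel V)

namespace FreeCGA

instance : Ring (FreeCGA V) := RingQuot.instRing _

instance : Algebra ℚ (FreeCGA V) := RingQuot.instAlgebra _

/-- The inclusion `V → ΛV` of the generators. -/
def ι : (⨁ p, V p) →ₗ[ℚ] FreeCGA V :=
  (RingQuot.mkAlgHom ℚ (FreeCGA.Rel V)).toLinearMap ∘ₗ TensorAlgebra.ι ℚ

/-- The inclusion `V^p → ΛV` of the generators of degree `p`. -/
def gen (p : ℕ) : V p →ₗ[ℚ] FreeCGA V := ι V ∘ₗ DirectSum.lof ℚ ℕ V p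

/-- `Λ^k V`, the part of wedge degree `k`: the linear span of the products of `k` generators. -/
def wedge (k : ℕ) : Submodule ℚ (FreeCGA V) := LinearMap.range (ι V) ^ k

/-- `(ΛV)^n`, the part of degree `n`: the linear span of the products `v₁ ⋯ v_k` of homogeneous
generators whose degrees add up to `n`. -/
def degree (n : ℕ) : Submodule ℚ (FreeCGA V) :=
  Submodule.span ℚ {a | ∃ l : List (Σ p, V p),
    (l.map fun x => x.1).sum = n ∧ (l.map fun x => gen V x.1 x.2).prod = a}

variable {V}

/-- An auxiliary matrix: the `(0, 3)` entry of `pairMatrix f g v * pairMatrix f g w` is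
`g v * f w + (-1)^{pq} * f v * g w`, the functionals `f`, `g` being extended by zero to `⨁ V^i`. -/
def pairMatrix {p q : ℕ} (f : Module.Dual ℚ (V p)) (g : Module.Dual ℚ (V q)) :
    (⨁ i, V i) →ₗ[ℚ] Matrix (Fin 4) (Fin 4) ℚ where
  toFun v := !![0, g (v q), (-1) ^ (p * q) * f (v p), 0;
                0, 0, 0, f (v p);
                0, 0, 0, g (v q);
                0, 0, 0, 0]
  map_add' v w := by
    ext i j; fin_cases i <;> fin_cases j <;> simp [mul_add]
  map_smul' c v := by
    have hc : ∀ r, (c • v) r = c • v r := fun r => DirectSum.smul_apply c v r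
    ext i j; fin_cases i <;> fin_cases j <;> simp [hc, mul_left_comm]

theorem pairMatrix_rel {p q : ℕ} (f : Module.Dual ℚ (V p)) (g : Module.Dual ℚ (V q))
    {i j : ℕ} (v : V i) (w : V j) :
    pairMatrix f g (DirectSum.lof ℚ ℕ V i v) * pairMatrix f g (DirectSum.lof ℚ ℕ V j w) =
      (-1 : ℚ) ^ (i * j) • (pairMatrix f g (DirectSum.lof ℚ ℕ V j w) *
        pairMatrix f g (DirectSum.lof ℚ ℕ V i v)) := by
  have key : g (DirectSum.lof ℚ ℕ V i v q) * f (DirectSum.lof ℚ ℕ V j w p) +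
      (-1) ^ (p * q) * f (DirectSum.lof ℚ ℕ V i v p) * g (DirectSum.lof ℚ ℕ V j w q) =
      (-1) ^ (i * j) * (g (DirectSum.lof ℚ ℕ V j w q) * f (DirectSum.lof ℚ ℕ V i v p) +
      (-1) ^ (p * q) * f (DirectSum.lof ℚ ℕ V j w p) * g (DirectSum.lof ℚ ℕ V i v q)) := by
    have hz : ∀ {a b : ℕ} (t : V a), a ≠ b → DirectSum.lof ℚ ℕ V a t b = 0 := fun t hab =>
      DirectSum.of_eq_of_ne _ _ t hab.symm
    have hs : ((-1 : ℚ) ^ (p * q)) * (-1) ^ (p * q) = 1 := by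
      rw [← mul_pow]; simp
    have hs' : ((-1 : ℚ) ^ (q * p)) = (-1) ^ (p * q) := by rw [mul_comm]
    by_cases h1 : i = p ∧ j = q
    · obtain ⟨rfl, rfl⟩ := h1
      linear_combination
        -(g (DirectSum.lof ℚ ℕ V i v j) * f (DirectSum.lof ℚ ℕ V j w i)) * hs
    · by_cases h2 : i = q ∧ j = p
      · obtain ⟨rfl, rfl⟩ := h2
        rw [hs']
        linear_combination
          -(g (DirectSum.lof ℚ ℕ V i v i) * f (DirectSum.lof ℚ ℕ V j w j)) * hs
      · have e1 : f (DirectSum.lof ℚ ℕ V i v p) * g (DirectSum.lof ℚ ℕ V j w q) = 0 := by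
          by_cases hi : i = p
          · rw [hz w (fun hj => h1 ⟨hi, hj⟩)]; simp
          · rw [hz v hi]; simp
        have e2 : g (DirectSum.lof ℚ ℕ V i v q) * f (DirectSum.lof ℚ ℕ V j w p) = 0 := by
          by_cases hi : i = q
          · rw [hz w (fun hj => h2 ⟨hi, hj⟩)]; simp
          · rw [hz v hi]; simp
        linear_combination (1 - (-1) ^ (i * j) * (-1) ^ (p * q)) * e2 +
          ((-1) ^ (p * q) - (-1) ^ (i * j)) * e1
  ext a b
  fin_cases a <;> fin_cases b <;> simp [pairMatrix, Matrix.mul_apply, Fin.sum_univ_four]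
  linear_combination key

/-- The pairing `Φ ↦ ⟨Φ; f, g⟩` of `ΛV` with two functionals `f : V^p → ℚ` and `g : V^q → ℚ`, given
on `Λ²V` by `⟨v ∧ w; f, g⟩ = ⟨v, g⟩ ⟨w, f⟩ + (-1)^{deg v deg w} ⟨w, g⟩ ⟨v, f⟩`
(see `pairing_gen_mul_gen`) and zero on `Λ^kV` for `k ≠ 2`. -/
def pairing {p q : ℕ} (f : Module.Dual ℚ (V p)) (g : Module.Dual ℚ (V q)) :
    FreeCGA V →ₗ[ℚ] ℚ :=
  Matrix.entryLinearMap ℚ ℚ (0 : Fin 4) (3 : Fin 4) ∘ₗ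
    (RingQuot.liftAlgHom ℚ (s := FreeCGA.Rel V)
      ⟨TensorAlgebra.lift ℚ (pairMatrix f g), by
        rintro _ _ ⟨v, w⟩
        simpa using pairMatrix_rel f g v w⟩).toLinearMap

theorem pairing_ι_mul_ι {p q : ℕ} (f : Module.Dual ℚ (V p)) (g : Module.Dual ℚ (V q))
    (v w : ⨁ i, V i) :
    pairing f g (ι V v * ι V w) = g (v q) * f (w p) + (-1) ^ (p * q) * (g (w q) * f (v p)) := by
  let F : FreeCGA V →ₐ[ℚ] Matrix (Fin 4) (Fin 4) ℚ := RingQuot.liftAlgHom ℚ (s := FreeCGA.Rel V)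
      ⟨TensorAlgebra.lift ℚ (pairMatrix f g), by
        rintro _ _ ⟨v, w⟩
        simpa using pairMatrix_rel f g v w⟩
  have h : ∀ x : ⨁ i, V i, F (ι V x) = pairMatrix f g x := fun x =>
    (RingQuot.liftAlgHom_mkAlgHom_apply ℚ _ _ (TensorAlgebra.ι ℚ x)).trans
      (TensorAlgebra.lift_ι_apply _ _)
  have h2 : pairing f g (ι V v * ι V w) = (pairMatrix f g v * pairMatrix f g w) 0 3 := by
    have h3 : F (ι V v * ι V w) = pairMatrix f g v * pairMatrix f g w := by
      rw [← h v, ← h w]; exact map_mul F _ _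
    rw [← h3]; rfl
  rw [h2]
  simp [pairMatrix, Matrix.mul_apply, Fin.sum_univ_four]
  ring

/-- The defining formula of the pairing on homogeneous generators `v` and `w`, in degrees where it
does not vanish. -/
theorem pairing_gen_mul_gen {p q : ℕ} (f : Module.Dual ℚ (V p)) (g : Module.Dual ℚ (V q))
    (i j : ℕ) (v : V i) (w : V j) :
    pairing f g (gen V i v * gen V j w) =
      g (DirectSum.lof ℚ ℕ V i v q) * f (DirectSum.lof ℚ ℕ V j w p) +
        (-1) ^ (i * j) * (g (DirectSum.lof ℚ ℕ V j w q) * f (DirectSum.lof ℚ ℕ V i v p)) := by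
  have hz : ∀ {a b : ℕ} (t : V a), a ≠ b → DirectSum.lof ℚ ℕ V a t b = 0 := fun t hab =>
    DirectSum.of_eq_of_ne _ _ t hab.symm
  have := pairing_ι_mul_ι f g (DirectSum.lof ℚ ℕ V i v) (DirectSum.lof ℚ ℕ V j w)
  refine this.trans ?_
  by_cases hi : i = p
  · by_cases hj : j = q
    · subst hi hj; rfl
    · simp [hz w hj]
  · simp [hz v hi]

end FreeCGA

/-- The filtration `V(0) = V ∩ ker d`, `V(n+1) = V ∩ d⁻¹(ΛV(n))` of `V = ⨁ V^p` defined by a linear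
map `d : ΛV → ΛV`. Here `ΛV(n) ⊆ ΛV` is the subalgebra generated by `V(n)`. -/
def sullivanFiltration (d : FreeCGA V →ₗ[ℚ] FreeCGA V) : ℕ → Submodule ℚ (⨁ p, V p)
  | 0 => LinearMap.ker (d ∘ₗ FreeCGA.ι V)
  | n + 1 => Submodule.comap (d ∘ₗ FreeCGA.ι V)
      (Subalgebra.toSubmodule
        (Algebra.adjoin ℚ (FreeCGA.ι V '' (sullivanFiltration d n : Set (⨁ p, V p)))))

end FreeAlgebra

/-- A `Λ`-algebra `(ΛV, d)`: the free graded commutative algebra on a graded rational vector space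
`V = V^{≥ 0}`, with a differential `d` (a derivation of degree `1` and square zero) which satisfies
the Sullivan condition `V = ⋃ V(n)`. -/
structure LambdaAlgebra where
  V : ℕ → Type u
  [addCommGroup : ∀ p, AddCommGroup (V p)]
  [module : ∀ p, Module ℚ (V p)]
  d : FreeCGA V →ₗ[ℚ] FreeCGA V
  d_degree : ∀ n, ∀ a ∈ FreeCGA.degree V n, d a ∈ FreeCGA.degree V (n + 1)
  d_mul : ∀ n, ∀ a ∈ FreeCGA.degree V n, ∀ b, d (a * b) = d a * b + (-1 : ℚ) ^ n • (a * d b)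
  d_d : ∀ a, d (d a) = 0
  sullivan : ∀ x : ⨁ p, V p, ∃ n, x ∈ sullivanFiltration V d n

attribute [instance] LambdaAlgebra.addCommGroup LambdaAlgebra.module

namespace LambdaAlgebra

/-- A quadratic Sullivan algebra: `V = V^{≥ 1}` and `d : V → Λ²V`. -/
structure IsQuadraticSullivan (A : LambdaAlgebra.{u}) : Prop where
  degree_pos : Subsingleton (A.V 0)
  quadratic : ∀ x, A.d (FreeCGA.ι A.V x) ∈ FreeCGA.wedge A.V 2

/-- The graded Lie algebra `E` is the homotopy Lie algebra of the quadratic Sullivan algebra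
`(ΛV, d)`: there is a suspension isomorphism `s : E_p ≅ (V^{p+1})^∨` for which
`⟨v, s[x, y]⟩ = (-1)^{deg y + 1} ⟨d v; sx, sy⟩`. -/
def IsHomotopyLieAlgebra (E : ℕ → Type v) [∀ p, AddCommGroup (E p)] [∀ p, Module ℚ (E p)]
    [GrLieAlgebra E] (A : LambdaAlgebra.{u}) : Prop :=
  ∃ s : ∀ p, E p ≃ₗ[ℚ] Module.Dual ℚ (A.V (p + 1)),
    ∀ (p q r : ℕ) (h : p + q = r) (x : E p) (y : E q) (w : A.V (r + 1)),
      s r (GrLieAlgebra.bracket h x y) w =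
        (-1) ^ (q + 1) * FreeCGA.pairing (s p x) (s q y) (A.d (FreeCGA.gen A.V (r + 1) w))

/-- Two `Λ`-algebras `ΛV` and `ΛW` with the differentials `d` are isomorphic by an isomorphism of
commutative differential graded algebras which moreover carries the generating space `V` onto `W`
(hence preserves the wedge degree). -/
def Isomorphic (A : LambdaAlgebra.{u}) (B : LambdaAlgebra.{v}) : Prop :=
  ∃ f : FreeCGA A.V ≃ₐ[ℚ] FreeCGA B.V,
    (∀ n, (FreeCGA.degree A.V n).map f.toLinearMap = FreeCGA.degree B.V n) ∧
    (LinearMap.range (FreeCGA.ι A.V)).map f.toLinearMap = LinearMap.range (FreeCGA.ι B.V) ∧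
    ∀ a, f (A.d a) = B.d (f a)

end LambdaAlgebra

end

universe w

noncomputable section

/-! The generators are forced: `W^{p+1}` is the continuous dual of `E_p`, the functionals vanishing
on some `E^n`.

Finite type of `E/E^2` passes to every `E/E^n`: in each degree `E^n/E^{n+1}` is spanned by brackets
of finitely many elements, only finitely many bidegrees being involved. A functional on `W^{p+1}`,
restricted to `(E_p/E^n)^∨`, is therefore evaluation at a class in `E_p/E^n`. These classes are
compatible, so pronilpotence yields one element of `E_p`. Thus `E_p ≅ (W^{p+1})^∨`
(`evaluation_injective`, `evaluation_surjective`).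

If `w` vanishes on `E^{m+1}`, then `(x, y) ↦ w [x, y]` factors through the finite dimensional
`E/E^m` in each variable, hence is a finite sum of products of functionals vanishing on `E^m`
(`exists_bracket_decomposition`). This defines `dw ∈ Λ²W`, and shows that `dw` lies in the
subalgebra on a smaller stage of the filtration, which is the Sullivan condition.

Identities in `ΛW` are checked by contraction. Over `ℚ`, Euler's formula shows that an element of
positive wedge degree killed by all contractions is zero (`eq_zero_of_contraction`). So `dw` is
unique, and `d²w ∈ Λ³W` vanishes because its triple contractions are the Jacobi identity
(`differential_differential_ι`).

For uniqueness, let `E` also be the homotopy Lie algebra of `ΛV`. By induction `V(n)` vanishes on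
`E^{n+2}` (`IsSuspension.sullivanFiltration_le`), so the Sullivan condition puts `V^{p+1}` inside
the continuous dual `W^{p+1}`. The inclusion is onto: a functional on `W^{p+1}` killing `V^{p+1}` is
evaluation at some `x ∈ E_p` whose suspension in `(V^{p+1})^∨` is zero, so `x = 0`. The induced map
of algebras commutes with `d`, as both composites have the same double contractions on generators.
-/

namespace FreeCGA

/-! ### The free graded commutative algebra: inductions, gradings, signs and derivations -/

section Basic

variable {V : ℕ → Type u} [∀ p, AddCommGroup (V p)] [∀ p, Module ℚ (V p)]

/-- The universal property of `ΛV`. -/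
def lift {A : Type*} [Ring A] [Algebra ℚ A] (g : (⨁ p, V p) →ₗ[ℚ] A)
    (h : ∀ (i j : ℕ) (v : V i) (w : V j),
      g (DirectSum.lof ℚ ℕ V i v) * g (DirectSum.lof ℚ ℕ V j w) = (-1 : ℚ) ^ (i * j) •
        (g (DirectSum.lof ℚ ℕ V j w) * g (DirectSum.lof ℚ ℕ V i v))) :
    FreeCGA V →ₐ[ℚ] A :=
  RingQuot.liftAlgHom ℚ (s := FreeCGA.Rel V) ⟨TensorAlgebra.lift ℚ g, by
    rintro _ _ ⟨v, w⟩
    simpa using h _ _ v w⟩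

theorem lift_ι {A : Type*} [Ring A] [Algebra ℚ A] (g : (⨁ p, V p) →ₗ[ℚ] A)
    (h : ∀ (i j : ℕ) (v : V i) (w : V j),
      g (DirectSum.lof ℚ ℕ V i v) * g (DirectSum.lof ℚ ℕ V j w) = (-1 : ℚ) ^ (i * j) •
        (g (DirectSum.lof ℚ ℕ V j w) * g (DirectSum.lof ℚ ℕ V i v)))
    (x : ⨁ p, V p) : lift g h (ι V x) = g x :=
  (RingQuot.liftAlgHom_mkAlgHom_apply ℚ _ _ (TensorAlgebra.ι ℚ x)).trans
    (TensorAlgebra.lift_ι_apply _ _)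

theorem ι_lof (i : ℕ) (v : V i) : ι V (DirectSum.lof ℚ ℕ V i v) = gen V i v := rfl

theorem gen_mul_gen (i j : ℕ) (v : V i) (w : V j) :
    gen V i v * gen V j w = (-1 : ℚ) ^ (i * j) • (gen V j w * gen V i v) := by
  have h := RingQuot.mkAlgHom_rel ℚ (FreeCGA.Rel.comm v w)
  rw [map_smul, map_mul, map_mul] at h
  exact h

/-- The projection of the tensor algebra onto `ΛV`. -/
def mk (V : ℕ → Type u) [∀ p, AddCommGroup (V p)] [∀ p, Module ℚ (V p)] :
    TensorAlgebra ℚ (⨁ p, V p) →ₐ[ℚ] FreeCGA V :=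
  RingQuot.mkAlgHom ℚ (FreeCGA.Rel V)

/-- Induction on the length of products of homogeneous generators. -/
theorem gen_mul_induction {C : FreeCGA V → Prop} (one : C 1)
    (add : ∀ a b, C a → C b → C (a + b)) (smul : ∀ (c : ℚ) a, C a → C (c • a))
    (gen_mul : ∀ (i : ℕ) (v : V i) a, C a → C (gen V i v * a)) (a : FreeCGA V) : C a := by
  have zero : C 0 := by simpa using smul 0 1 one
  have key : ∀ t : TensorAlgebra ℚ (⨁ p, V p), ∀ b, C b →
      C (mk V t * b) := by
    intro t
    induction t using TensorAlgebra.induction with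
    | algebraMap r =>
      intro b hb
      have : mk V (algebraMap ℚ _ r) * b = r • b := by
        rw [Algebra.smul_def, AlgHom.commutes]
      rw [this]
      exact smul r b hb
    | ι x =>
      intro b hb
      change C (ι V x * b)
      induction x using DirectSum.induction_on with
      | zero => simpa using zero
      | of i v => exact gen_mul i v b hb
      | add x y hx hy =>
        rw [map_add, add_mul]
        exact add _ _ hx hy
    | mul s t hs ht =>
      intro b hb
      have : mk V (s * t) * b =
          mk V s *
            (mk V t * b) := by
        rw [← mul_assoc, map_mul]
      rw [this]
      exact hs _ (ht _ hb)
    | add s t hs ht =>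
      intro b hb
      have : mk V (s + t) * b =
          mk V s * b +
            mk V t * b := by
        rw [← add_mul, map_add]
      rw [this]
      exact add _ _ (hs _ hb) (ht _ hb)
  obtain ⟨t, ht⟩ := RingQuot.mkAlgHom_surjective ℚ (FreeCGA.Rel V) a
  have := key t 1 one
  rw [mul_one] at this
  exact ht ▸ this

theorem algHom_ext {A : Type*} [Ring A] [Algebra ℚ A] {f g : FreeCGA V →ₐ[ℚ] A}
    (h : ∀ i (v : V i), f (gen V i v) = g (gen V i v)) : f = g := by
  ext a
  induction a using gen_mul_induction with
  | one => simp
  | add a b ha hb => rw [map_add, map_add, ha, hb]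
  | smul c a ha => rw [map_smul, map_smul, ha]
  | gen_mul i v a ha => rw [map_mul, map_mul, ha, h]

/-! ### The two gradings -/

theorem gen_mem_degree (i : ℕ) (v : V i) : gen V i v ∈ degree V i :=
  Submodule.subset_span ⟨[⟨i, v⟩], by simp, by simp⟩

theorem one_mem_degree : (1 : FreeCGA V) ∈ degree V 0 :=
  Submodule.subset_span ⟨[], by simp, by simp⟩

theorem mul_mem_degree {m n : ℕ} {a b : FreeCGA V} (ha : a ∈ degree V m) (hb : b ∈ degree V n) :
    a * b ∈ degree V (m + n) := by
  have h : degree V m * degree V n ≤ degree V (m + n) := by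
    rw [degree, degree, Submodule.span_mul_span]
    refine Submodule.span_mono ?_
    rintro _ ⟨_, ⟨l, hl, rfl⟩, _, ⟨l', hl', rfl⟩, rfl⟩
    exact ⟨l ++ l', by simp [hl, hl'], by simp⟩
  exact h (Submodule.mul_mem_mul ha hb)

/-- Induction on elements of a given degree. -/
theorem degree_induction {C : ℕ → FreeCGA V → Prop} (one : C 0 1) (zero : ∀ n, C n 0)
    (add : ∀ n a b, C n a → C n b → C n (a + b)) (smul : ∀ n (c : ℚ) a, C n a → C n (c • a))
    (gen_mul : ∀ (i n : ℕ) (v : V i) a, a ∈ degree V n → C n a → C (i + n) (gen V i v * a))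
    {n : ℕ} {a : FreeCGA V} (ha : a ∈ degree V n) : C n a := by
  induction ha using Submodule.span_induction with
  | mem x hx =>
    obtain ⟨l, hl, rfl⟩ := hx
    induction l generalizing n with
    | nil =>
      obtain rfl : 0 = n := by simpa using hl
      simpa using one
    | cons p l ih =>
      obtain rfl : p.1 + (l.map fun x => x.1).sum = n := by simpa using hl
      simp only [List.map_cons, List.prod_cons]
      exact gen_mul _ _ _ _ (Submodule.subset_span ⟨l, rfl, rfl⟩) (ih rfl)
  | zero => exact zero n
  | add a b _ _ ha hb => exact add n a b ha hb
  | smul c a _ ha => exact smul n c a ha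

theorem gen_mul_degree (i n : ℕ) (v : V i) {a : FreeCGA V} (ha : a ∈ degree V n) :
    gen V i v * a = (-1 : ℚ) ^ (i * n) • (a * gen V i v) := by
  refine degree_induction (C := fun n a => gen V i v * a = (-1 : ℚ) ^ (i * n) • (a * gen V i v))
    (by simp) (by simp) ?_ ?_ ?_ ha
  · intro n a b ha hb
    rw [mul_add, add_mul, ha, hb, smul_add]
  · intro n c a ha
    rw [mul_smul_comm, ha, smul_mul_assoc, smul_comm]
  · intro j n w a _ h
    rw [← mul_assoc, gen_mul_gen, smul_mul_assoc, mul_assoc, h, mul_smul_comm, smul_smul, mul_assoc,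
      mul_add, pow_add]

theorem wedge_one : wedge V 1 = LinearMap.range (ι V) := pow_one _

theorem mul_mem_wedge {m n : ℕ} {a b : FreeCGA V} (ha : a ∈ wedge V m) (hb : b ∈ wedge V n) :
    a * b ∈ wedge V (m + n) := by
  rw [wedge, pow_add]
  exact Submodule.mul_mem_mul ha hb

theorem ι_mem_wedge (x : ⨁ p, V p) : ι V x ∈ wedge V 1 := by
  rw [wedge_one]
  exact ⟨x, rfl⟩

theorem gen_mem_wedge (i : ℕ) (v : V i) : gen V i v ∈ wedge V 1 := ι_mem_wedge _

/-! ### Sign automorphisms -/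

/-- The linear map `v ↦ (-1)^{ε deg v} v`. -/
def signLinear (ε : ℕ) : (⨁ p, V p) →ₗ[ℚ] FreeCGA V :=
  DirectSum.toModule ℚ ℕ _ fun i => (-1 : ℚ) ^ (ε * i) • gen V i

theorem signLinear_lof (ε i : ℕ) (v : V i) :
    signLinear ε (DirectSum.lof ℚ ℕ V i v) = (-1 : ℚ) ^ (ε * i) • gen V i v := by
  simp [signLinear, DirectSum.toModule_lof]

/-- The algebra endomorphism of `ΛV` which multiplies elements of degree `n` by `(-1)^{εn}`. -/
def sgn (ε : ℕ) : FreeCGA V →ₐ[ℚ] FreeCGA V :=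
  lift (signLinear ε) fun i j v w => by
    rw [signLinear_lof, signLinear_lof, smul_mul_smul_comm, smul_mul_smul_comm, gen_mul_gen,
      smul_smul, smul_smul]
    congr 1
    ring

theorem sgn_gen (ε i : ℕ) (v : V i) : sgn ε (gen V i v) = (-1 : ℚ) ^ (ε * i) • gen V i v :=
  (lift_ι _ _ _).trans (signLinear_lof ε i v)

theorem sgn_degree (ε : ℕ) {n : ℕ} {a : FreeCGA V} (ha : a ∈ degree V n) :
    sgn ε a = (-1 : ℚ) ^ (ε * n) • a := by
  refine degree_induction (C := fun n a => sgn ε a = (-1 : ℚ) ^ (ε * n) • a)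
    (by simp) (by simp) ?_ ?_ ?_ ha
  · intro n a b ha hb
    rw [map_add, ha, hb, smul_add]
  · intro n c a ha
    rw [map_smul, ha, smul_comm]
  · intro j n w a _ h
    rw [map_mul, sgn_gen, h, smul_mul_smul_comm, mul_add, pow_add]

theorem sgn_sgn (ε δ : ℕ) (a : FreeCGA V) : sgn ε (sgn δ a) = sgn (ε + δ) a := by
  have : (sgn ε).comp (sgn δ) = (sgn (ε + δ) : FreeCGA V →ₐ[ℚ] FreeCGA V) := by
    refine algHom_ext fun i v => ?_
    rw [AlgHom.comp_apply, sgn_gen, map_smul, sgn_gen, sgn_gen, smul_smul, add_mul, pow_add,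
      mul_comm]
  exact DFunLike.congr_fun this a

theorem sgn_add_two (ε : ℕ) : (sgn (ε + 2) : FreeCGA V →ₐ[ℚ] FreeCGA V) = sgn ε := by
  refine algHom_ext fun i v => ?_
  rw [sgn_gen, sgn_gen, add_mul, pow_add, pow_mul _ 2]
  simp

/-- The sign of a transposition depends on the degree of each component of `x`; the twist `sgn i`
absorbs all of them at once. This moves a basis element past `x` in Euler's formula. -/
theorem gen_mul_sgn_ι (i : ℕ) (v : V i) (x : ⨁ p, V p) :
    gen V i v * sgn i (ι V x) = ι V x * gen V i v := by
  induction x using DirectSum.induction_on with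
  | zero => simp
  | of j w =>
    change gen V i v * sgn i (gen V j w) = gen V j w * gen V i v
    rw [sgn_gen, mul_smul_comm, gen_mul_gen, smul_smul, ← mul_pow]
    simp
  | add x y hx hy => rw [map_add, map_add, mul_add, hx, hy, add_mul]

/-! ### Graded derivations -/

/-- A derivation `D` of `ΛV` whose degree has the parity of `ε`. -/
structure IsDerivation (ε : ℕ) (D : FreeCGA V →ₗ[ℚ] FreeCGA V) : Prop where
  map_mul : ∀ a b, D (a * b) = D a * b + sgn ε a * D b
  map_sgn : ∀ δ a, sgn δ (D a) = (-1 : ℚ) ^ (δ * ε) • D (sgn δ a)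

namespace IsDerivation

theorem map_one {ε : ℕ} {D : FreeCGA V →ₗ[ℚ] FreeCGA V} (h : IsDerivation ε D) : D 1 = 0 := by
  have := h.map_mul 1 1
  simpa using this

theorem map_algebraMap {ε : ℕ} {D : FreeCGA V →ₗ[ℚ] FreeCGA V} (h : IsDerivation ε D) (c : ℚ) :
    D (algebraMap ℚ _ c) = 0 := by
  rw [Algebra.algebraMap_eq_smul_one, map_smul, h.map_one, smul_zero]

theorem map_gen_mul {ε : ℕ} {D : FreeCGA V →ₗ[ℚ] FreeCGA V} (h : IsDerivation ε D) (i : ℕ)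
    (v : V i) (a : FreeCGA V) :
    D (gen V i v * a) = D (gen V i v) * a + (-1 : ℚ) ^ (ε * i) • (gen V i v * D a) := by
  rw [h.map_mul, sgn_gen, smul_mul_assoc]

theorem ext {ε : ℕ} {D D' : FreeCGA V →ₗ[ℚ] FreeCGA V} (h : IsDerivation ε D)
    (h' : IsDerivation ε D') (hg : ∀ i (v : V i), D (gen V i v) = D' (gen V i v)) : D = D' := by
  ext a
  induction a using gen_mul_induction with
  | one => rw [h.map_one, h'.map_one]
  | add a b ha hb => rw [map_add, map_add, ha, hb]
  | smul c a ha => rw [map_smul, map_smul, ha]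
  | gen_mul i v a ha => rw [h.map_gen_mul, h'.map_gen_mul, ha, hg]

theorem zero (ε : ℕ) : IsDerivation ε (0 : FreeCGA V →ₗ[ℚ] FreeCGA V) :=
  ⟨by simp, by simp⟩

theorem smul {ε : ℕ} {D : FreeCGA V →ₗ[ℚ] FreeCGA V} (h : IsDerivation ε D) (c : ℚ) :
    IsDerivation ε (c • D) where
  map_mul a b := by simp [h.map_mul]
  map_sgn δ a := by
    simp only [LinearMap.smul_apply, map_smul, h.map_sgn]
    rw [smul_comm]

/-- Only the parity of `ε` enters the signs. A contraction of degree `-p` can thus be recorded with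
the natural number `p`, and degrees of commutators adjusted by 2. -/
theorem of_add_two {ε : ℕ} {D : FreeCGA V →ₗ[ℚ] FreeCGA V} (h : IsDerivation (ε + 2) D) :
    IsDerivation ε D where
  map_mul a b := by rw [h.map_mul, sgn_add_two]
  map_sgn δ a := by
    rw [h.map_sgn, mul_add, pow_add, mul_comm δ 2, pow_mul _ 2]
    simp

/-- The graded commutator of two graded derivations. -/
theorem commutator {ε δ : ℕ} {D D' : FreeCGA V →ₗ[ℚ] FreeCGA V} (h : IsDerivation ε D)
    (h' : IsDerivation δ D') :
    IsDerivation (ε + δ) (D ∘ₗ D' + (-(-1 : ℚ) ^ (ε * δ)) • D' ∘ₗ D) where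
  map_mul a b := by
    simp only [LinearMap.add_apply, LinearMap.smul_apply, LinearMap.comp_apply, h.map_mul,
      h'.map_mul, map_add, h.map_sgn, h'.map_sgn, sgn_sgn, add_comm δ ε, mul_comm δ ε]
    -- The mixed terms, with one derivation on each factor, cancel in the commutator because the
    -- sign squares to one.
    have hs : (-1 : ℚ) ^ (ε * δ) * (-1 : ℚ) ^ (ε * δ) = 1 := by rw [← mul_pow]; simp
    generalize (-1 : ℚ) ^ (ε * δ) = s at hs ⊢
    simp only [smul_mul_assoc, add_mul, mul_add, mul_smul_comm]
    match_scalars <;> first | ring1 | linear_combination -hs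
  map_sgn γ a := by
    simp only [LinearMap.add_apply, LinearMap.smul_apply, LinearMap.comp_apply, map_add, map_smul,
      h.map_sgn, h'.map_sgn, smul_add, smul_smul]
    congr 2 <;> ring

end IsDerivation

section Extend

variable (ε : ℕ) (θ : (⨁ p, V p) →ₗ[ℚ] FreeCGA V)

/-- The matrices which encode the extension of `θ : V → ΛV` to a derivation. -/
def derivationMatrix : (⨁ p, V p) →ₗ[ℚ] Matrix (Fin 2) (Fin 2) (FreeCGA V) where
  toFun x := !![sgn ε (ι V x), θ x; 0, ι V x]
  map_add' x y := by ext i j; fin_cases i <;> fin_cases j <;> simp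
  map_smul' c x := by ext i j; fin_cases i <;> fin_cases j <;> simp

variable (h : ∀ (i j : ℕ) (v : V i) (w : V j),
  (-1 : ℚ) ^ (ε * i) • (gen V i v * θ (DirectSum.lof ℚ ℕ V j w)) +
      θ (DirectSum.lof ℚ ℕ V i v) * gen V j w =
    (-1 : ℚ) ^ (i * j) • ((-1 : ℚ) ^ (ε * j) • (gen V j w * θ (DirectSum.lof ℚ ℕ V i v)) +
      θ (DirectSum.lof ℚ ℕ V j w) * gen V i v))

-- The diagonal entries of the matrix relation are graded commutativity and its image under `sgn ε`;
-- the entry `(0, 1)` is the hypothesis `h`, that `θ` is compatible with the relations of `ΛV`.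
include h in
theorem derivationMatrix_rel (i j : ℕ) (v : V i) (w : V j) :
    derivationMatrix ε θ (DirectSum.lof ℚ ℕ V i v) * derivationMatrix ε θ (DirectSum.lof ℚ ℕ V j w)
      = (-1 : ℚ) ^ (i * j) • (derivationMatrix ε θ (DirectSum.lof ℚ ℕ V j w) *
        derivationMatrix ε θ (DirectSum.lof ℚ ℕ V i v)) := by
  have h1 := gen_mul_gen i j v w
  have h2 := congrArg (sgn ε) h1
  rw [map_smul, map_mul, map_mul] at h2
  have h3 := h i j v w
  rw [← smul_mul_assoc, ← smul_mul_assoc, ← sgn_gen, ← sgn_gen] at h3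
  ext a b
  fin_cases a <;> fin_cases b <;>
    simp [derivationMatrix, Matrix.mul_apply, ι_lof, h1, h2, h3]

/-- The algebra homomorphism `a ↦ !![sgn ε a, D a; 0, a]`. -/
def derivationHom : FreeCGA V →ₐ[ℚ] Matrix (Fin 2) (Fin 2) (FreeCGA V) :=
  lift (derivationMatrix ε θ) (derivationMatrix_rel ε θ h)

/-- The extension of `θ : V → ΛV` to a derivation of `ΛV`. -/
def derivation : FreeCGA V →ₗ[ℚ] FreeCGA V :=
  Matrix.entryLinearMap ℚ _ (0 : Fin 2) (1 : Fin 2) ∘ₗ (derivationHom ε θ h).toLinearMap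

theorem derivation_ι (x : ⨁ p, V p) : derivation ε θ h (ι V x) = θ x := by
  change (derivationHom ε θ h (ι V x)) 0 1 = _
  rw [derivationHom, lift_ι]
  simp [derivationMatrix]

theorem derivationHom_apply (a : FreeCGA V) :
    derivationHom ε θ h a = !![sgn ε a, derivation ε θ h a; 0, a] := by
  have key : derivationHom ε θ h a 0 0 = sgn ε a ∧ derivationHom ε θ h a 1 0 = 0 ∧
      derivationHom ε θ h a 1 1 = a := by
    induction a using gen_mul_induction with
    | one => simp
    | add a b ha hb => simp [ha, hb]
    | smul c a ha => simp [ha]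
    | gen_mul i v a ha =>
      have hv : derivationHom ε θ h (gen V i v) =
        derivationMatrix ε θ (DirectSum.lof ℚ ℕ V i v) := lift_ι _ _ _
      simp [hv, Matrix.mul_apply, ha, derivationMatrix, ι_lof]
  ext i j
  fin_cases i <;> fin_cases j
  · exact key.1
  · rfl
  · exact key.2.1
  · exact key.2.2

/-- The twisted Leibniz rule is the entry `(0, 1)` of the multiplicativity of `derivationHom`. The
hypothesis `hs` says that `θ` shifts parity by `ε`, and spreads from generators to products. -/
theorem isDerivation_derivation
    (hs : ∀ δ i (v : V i), sgn δ (θ (DirectSum.lof ℚ ℕ V i v)) =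
      (-1 : ℚ) ^ (δ * (ε + i)) • θ (DirectSum.lof ℚ ℕ V i v)) :
    IsDerivation ε (derivation ε θ h) := by
  have hmul : ∀ a b, derivation ε θ h (a * b) =
      derivation ε θ h a * b + sgn ε a * derivation ε θ h b := by
    intro a b
    have := congrFun (congrFun (map_mul (derivationHom ε θ h) a b) 0) 1
    rw [derivationHom_apply, derivationHom_apply, derivationHom_apply] at this
    simpa [Matrix.mul_apply, add_comm] using this
  refine ⟨hmul, fun δ a => ?_⟩
  induction a using gen_mul_induction with
  | one =>
    have : derivation ε θ h 1 = 0 := by simpa using hmul 1 1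
    simp [this]
  | add a b ha hb => rw [map_add, map_add, ha, hb, map_add, map_add, smul_add]
  | smul c a ha => rw [map_smul, map_smul, ha, map_smul, map_smul, smul_comm]
  | gen_mul i v a ha =>
    have hv : derivation ε θ h (gen V i v) = θ (DirectSum.lof ℚ ℕ V i v) := derivation_ι _ _ _ _
    rw [hmul, map_add, map_mul, map_mul, ha, map_mul, hmul, hv, hs, sgn_gen, sgn_gen, map_smul,
      map_smul, map_smul, hv, sgn_gen, sgn_gen]
    simp only [smul_mul_assoc, mul_smul_comm, smul_add, smul_smul]
    congr 2 <;> ring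

end Extend

end Basic

end FreeCGA

/-! ### Contractions and Euler's formula -/

namespace FreeCGA

section Contraction

variable {V : ℕ → Type u} [∀ p, AddCommGroup (V p)] [∀ p, Module ℚ (V p)]

theorem lof_apply_of_ne {i p : ℕ} (v : V i) (h : i ≠ p) : DirectSum.lof ℚ ℕ V i v p = 0 :=
  DirectSum.of_eq_of_ne _ _ v h.symm

theorem lof_apply_self (i : ℕ) (v : V i) : DirectSum.lof ℚ ℕ V i v i = v :=
  DirectSum.of_eq_same _ v

theorem neg_one_pow_mul_self (n : ℕ) : (-1 : ℚ) ^ n * (-1 : ℚ) ^ n = 1 := by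
  rw [← mul_pow]; simp

/-- A functional on `V^p`, extended by zero to `V` and regarded as a map into `ΛV`. -/
def dualExtend {p : ℕ} (f : Module.Dual ℚ (V p)) : (⨁ i, V i) →ₗ[ℚ] FreeCGA V :=
  Algebra.linearMap ℚ (FreeCGA V) ∘ₗ f ∘ₗ DirectSum.component ℚ ℕ V p

theorem dualExtend_apply {p : ℕ} (f : Module.Dual ℚ (V p)) (x : ⨁ i, V i) :
    dualExtend f x = algebraMap ℚ (FreeCGA V) (f (x p)) := rfl

theorem dualExtend_rel {p : ℕ} (f : Module.Dual ℚ (V p)) (i j : ℕ) (v : V i) (w : V j) :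
    (-1 : ℚ) ^ (p * i) • (gen V i v * dualExtend f (DirectSum.lof ℚ ℕ V j w)) +
      dualExtend f (DirectSum.lof ℚ ℕ V i v) * gen V j w =
    (-1 : ℚ) ^ (i * j) • ((-1 : ℚ) ^ (p * j) • (gen V j w * dualExtend f (DirectSum.lof ℚ ℕ V i v)) +
      dualExtend f (DirectSum.lof ℚ ℕ V j w) * gen V i v) := by
  simp only [dualExtend_apply, ← Algebra.smul_def, ← Algebra.commutes]
  by_cases hi : i = p
  · subst hi
    by_cases hj : j = i
    · subst hj
      simp only [smul_add, smul_smul, ← mul_assoc, neg_one_pow_mul_self, one_mul]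
      exact add_comm _ _
    · simp only [lof_apply_of_ne w hj, map_zero, zero_smul, smul_zero, zero_add, add_zero,
        smul_smul, ← mul_assoc, neg_one_pow_mul_self, one_mul]
  · by_cases hj : j = p
    · subst hj
      simp only [lof_apply_of_ne v hi, map_zero, zero_smul, smul_zero, zero_add, add_zero,
        mul_comm j i]
    · rw [lof_apply_of_ne w hj, lof_apply_of_ne v hi]
      simp

/-- The contraction of `ΛV` by a functional on `V^p`: the derivation of degree `-p` which extends
this functional. -/
def contraction {p : ℕ} (f : Module.Dual ℚ (V p)) : FreeCGA V →ₗ[ℚ] FreeCGA V :=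
  derivation p (dualExtend f) (dualExtend_rel f)

theorem isDerivation_contraction {p : ℕ} (f : Module.Dual ℚ (V p)) :
    IsDerivation p (contraction f) := by
  refine isDerivation_derivation _ _ _ fun δ i v => ?_
  rw [dualExtend_apply]
  by_cases hi : i = p
  · subst hi
    rw [AlgHom.commutes, mul_add, pow_add, neg_one_pow_mul_self, one_smul]
  · rw [lof_apply_of_ne v hi]
    simp

theorem contraction_ι {p : ℕ} (f : Module.Dual ℚ (V p)) (x : ⨁ i, V i) :
    contraction f (ι V x) = algebraMap ℚ _ (f (x p)) := derivation_ι _ _ _ _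

theorem contraction_algebraMap {p : ℕ} (f : Module.Dual ℚ (V p)) (c : ℚ) :
    contraction f (algebraMap ℚ _ c) = 0 := (isDerivation_contraction f).map_algebraMap c

theorem algebraMap_injective : Function.Injective (algebraMap ℚ (FreeCGA V)) := by
  let F : FreeCGA V →ₐ[ℚ] ℚ := lift 0 (by simp)
  intro a b h
  simpa using congrArg F h

theorem contraction_ι_mul {p : ℕ} (f : Module.Dual ℚ (V p)) (x : ⨁ i, V i) (a : FreeCGA V) :
    contraction f (ι V x * a) = f (x p) • a + sgn p (ι V x) * contraction f a := by
  rw [(isDerivation_contraction f).map_mul, contraction_ι, ← Algebra.smul_def]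

theorem sgn_ι_mem_wedge (ε : ℕ) (x : ⨁ p, V p) : sgn ε (ι V x) ∈ wedge V 1 := by
  induction x using DirectSum.induction_on with
  | zero => simp
  | of i v =>
    change sgn ε (gen V i v) ∈ _
    rw [sgn_gen]
    exact Submodule.smul_mem _ _ (gen_mem_wedge i v)
  | add x y hx hy =>
    rw [map_add, map_add]
    exact add_mem hx hy

theorem contraction_mem_wedge {p : ℕ} (f : Module.Dual ℚ (V p)) {k : ℕ} {a : FreeCGA V}
    (ha : a ∈ wedge V (k + 1)) : contraction f a ∈ wedge V k := by
  -- For `n = 0` the truncated `n - 1` says too little: multiplying back by a generator would only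
  -- give wedge degree 1 where 0 is needed. The second clause, that scalars are killed, repairs
  -- this.
  have key : ∀ n, ∀ a ∈ wedge V n, contraction f a ∈ wedge V (n - 1) ∧
      (n = 0 → contraction f a = 0) := by
    intro n a ha
    induction ha using Submodule.pow_induction_on_left' with
    | algebraMap r => simp [contraction_algebraMap]
    | add a b n _ _ ha hb =>
      rw [map_add]
      exact ⟨add_mem ha.1 hb.1, fun h => by rw [ha.2 h, hb.2 h, add_zero]⟩
    | mem_mul m hm n a h ha =>
      obtain ⟨x, rfl⟩ := hm
      refine ⟨?_, fun h => by simp at h⟩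
      rw [contraction_ι_mul]
      refine add_mem (Submodule.smul_mem _ _ h) ?_
      rcases n with _ | n
      · rw [ha.2 rfl, mul_zero]
        exact zero_mem _
      · have := mul_mem_wedge (sgn_ι_mem_wedge p x) ha.1
        rwa [add_comm] at this
  exact (key _ a ha).1

/-- `Finset.sum_mul`, which does not unify with the instances on `ΛV`. -/
theorem sum_mul' {κ : Type*} (F : Finset κ) (f : κ → FreeCGA V) (a : FreeCGA V) :
    (∑ k ∈ F, f k) * a = ∑ k ∈ F, f k * a := Finset.sum_mul F f a

/-- `Finset.mul_sum`, which does not unify with the instances on `ΛV`. -/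
theorem mul_sum' {κ : Type*} (F : Finset κ) (f : κ → FreeCGA V) (a : FreeCGA V) :
    a * ∑ k ∈ F, f k = ∑ k ∈ F, a * f k := Finset.mul_sum F f a

/-- The index set of a basis of `⨁ V^p` consisting of homogeneous elements. -/
abbrev BasisIndex (V : ℕ → Type u) [∀ p, AddCommGroup (V p)] [∀ p, Module ℚ (V p)] :=
  Σ p, Module.Basis.ofVectorSpaceIndex ℚ (V p)

/-- The homogeneous basis element of `ΛV` with a given index. -/
def basisGen (β : BasisIndex V) : FreeCGA V :=
  gen V β.1 (Module.Basis.ofVectorSpace ℚ (V β.1) β.2)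

/-- The contraction by the functional dual to a homogeneous basis element. -/
def basisContraction (β : BasisIndex V) : FreeCGA V →ₗ[ℚ] FreeCGA V :=
  contraction ((Module.Basis.ofVectorSpace ℚ (V β.1)).coord β.2)

/-- The basis may be infinite, but a given vector involves only finitely many of its elements.
Asking the identity for all large finite sets lets finitely many such conditions be combined without
tracking supports. -/
theorem eventually_sum_ι (x : ⨁ p, V p) : ∀ᶠ F : Finset (BasisIndex V) in Filter.atTop,
    ∑ β ∈ F, (Module.Basis.ofVectorSpace ℚ (V β.1)).coord β.2 (x β.1) • basisGen β = ι V x := by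
  classical
  induction x using DirectSum.induction_on with
  | zero => simp
  | of i v =>
    change ∀ᶠ F : Finset (BasisIndex V) in Filter.atTop, ∑ β ∈ F,
      (Module.Basis.ofVectorSpace ℚ (V β.1)).coord β.2 (DirectSum.lof ℚ ℕ V i v β.1) • basisGen β =
        gen V i v
    set b := Module.Basis.ofVectorSpace ℚ (V i) with hb
    filter_upwards [Filter.eventually_ge_atTop ((b.repr v).support.map
      ⟨Sigma.mk i, sigma_mk_injective⟩)] with F hF
    rw [← Finset.sum_subset hF]
    · rw [Finset.sum_map]
      conv_rhs => rw [← b.linearCombination_repr v, Finsupp.linearCombination_apply, Finsupp.sum,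
        map_sum]
      refine Finset.sum_congr rfl fun k _ => ?_
      rw [map_smul]
      simp only [Function.Embedding.coeFn_mk, lof_apply_self]
      rfl
    · rintro ⟨j, k⟩ _ hk
      by_cases hj : i = j
      · subst hj
        rw [lof_apply_self]
        have : b.repr v k = 0 := by
          by_contra hne
          exact hk (Finset.mem_map.2 ⟨k, Finsupp.mem_support_iff.2 hne, rfl⟩)
        change b.repr v k • _ = _
        rw [this, zero_smul]
      · rw [lof_apply_of_ne v hj]
        simp
  | add x y hx hy =>
    filter_upwards [hx, hy] with F hx hy
    rw [map_add, ← hx, ← hy, ← Finset.sum_add_distrib]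
    refine Finset.sum_congr rfl fun β _ => ?_
    rw [DirectSum.add_apply, map_add, add_smul]

/-- Euler's formula: `∑ b ∧ i_{b*} a = k a` for `a ∈ Λ^kV`. -/
theorem eventually_sum_contraction {k : ℕ} {a : FreeCGA V} (ha : a ∈ wedge V k) :
    ∀ᶠ F : Finset (BasisIndex V) in Filter.atTop,
      ∑ β ∈ F, basisGen β * basisContraction β a = (k : ℚ) • a := by
  induction ha using Submodule.pow_induction_on_left' with
  | algebraMap r => simp [basisContraction, contraction_algebraMap]
  | add a b n _ _ ha hb =>
    filter_upwards [ha, hb] with F ha hb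
    rw [smul_add, ← ha, ← hb, ← Finset.sum_add_distrib]
    exact Finset.sum_congr rfl fun β _ => by rw [map_add, mul_add]
  | mem_mul m hm n a _ ha =>
    obtain ⟨x, rfl⟩ := hm
    filter_upwards [ha, eventually_sum_ι x] with F ha hx
    have : ∀ β ∈ F, basisGen β * basisContraction β (ι V x * a) =
        (Module.Basis.ofVectorSpace ℚ (V β.1)).coord β.2 (x β.1) • basisGen β * a +
          ι V x * (basisGen β * basisContraction β a) := by
      intro β _
      rw [basisContraction, contraction_ι_mul, mul_add, ← mul_assoc, ← mul_assoc, basisGen,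
        gen_mul_sgn_ι, smul_mul_assoc, mul_smul_comm]
    rw [Finset.sum_congr rfl this, Finset.sum_add_distrib, ← sum_mul', ← mul_sum', hx, ha]
    push_cast
    rw [mul_smul_comm, add_smul, one_smul, add_comm]

/-- Euler's formula gives `(k + 1) a = 0`, and `k + 1` is invertible in `ℚ`. This is the substitute
for a basis of `ΛV` throughout. -/
theorem eq_zero_of_contraction {k : ℕ} {a : FreeCGA V} (ha : a ∈ wedge V (k + 1))
    (h : ∀ p (f : Module.Dual ℚ (V p)), contraction f a = 0) : a = 0 := by
  obtain ⟨F, hF⟩ := (eventually_sum_contraction ha).exists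
  rw [Finset.sum_eq_zero fun β _ => by rw [basisContraction, h, mul_zero]] at hF
  refine (smul_eq_zero.1 hF.symm).resolve_left ?_
  exact_mod_cast Nat.succ_ne_zero k

theorem contraction_contraction_ι_mul_ι {p q : ℕ} (f : Module.Dual ℚ (V p))
    (g : Module.Dual ℚ (V q)) (x y : ⨁ i, V i) :
    contraction f (contraction g (ι V x * ι V y)) =
      algebraMap ℚ _ (g (x q) * f (y p) + (-1) ^ (p * q) * (g (y q) * f (x p))) := by
  rw [contraction_ι_mul, map_add, map_smul, contraction_ι, contraction_ι, ← Algebra.commutes,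
    ← Algebra.smul_def, map_smul]
  have h := (isDerivation_contraction f).map_sgn q (ι V x)
  rw [contraction_ι, AlgHom.commutes] at h
  have h2 : contraction f (sgn q (ι V x)) = (-1 : ℚ) ^ (q * p) • algebraMap ℚ _ (f (x p)) := by
    rw [h, smul_smul, neg_one_pow_mul_self, one_smul]
  rw [h2]
  simp only [Algebra.smul_def, ← map_mul, ← map_add]
  congr 1
  rw [mul_comm q p]
  ring

theorem wedge_two_induction {C : FreeCGA V → Prop} (mul : ∀ x y, C (ι V x * ι V y))
    (add : ∀ a b, C a → C b → C (a + b)) {a : FreeCGA V} (ha : a ∈ wedge V 2) : C a := by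
  rw [wedge, pow_two] at ha
  induction ha using Submodule.mul_induction_on' with
  | mem_mul_mem m hm n hn =>
    obtain ⟨x, rfl⟩ := hm
    obtain ⟨y, rfl⟩ := hn
    exact mul x y
  | add a _ b _ ha hb => exact add a b ha hb

/-- This replaces the pairing in the definition of the homotopy Lie algebra by derivations, for
which commutator calculus is available. -/
theorem contraction_contraction {p q : ℕ} (f : Module.Dual ℚ (V p)) (g : Module.Dual ℚ (V q))
    {a : FreeCGA V} (ha : a ∈ wedge V 2) :
    contraction f (contraction g a) = algebraMap ℚ _ (pairing f g a) := by
  refine wedge_two_induction (C := fun a => contraction f (contraction g a) =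
    algebraMap ℚ _ (pairing f g a)) (fun x y => ?_) (fun a b ha hb => ?_) ha
  · rw [contraction_contraction_ι_mul_ι, pairing_ι_mul_ι]
  · rw [map_add, map_add, map_add, map_add, ha, hb]

end Contraction

end FreeCGA

/-! ### The lower central series and finite type -/

namespace GrLieAlgebra

section LowerCentral

variable {E : ℕ → Type u} [∀ p, AddCommGroup (E p)] [∀ p, Module ℚ (E p)] [GrLieAlgebra E]

theorem bracket_mem_lowerCentral_right {i j k : ℕ} (h : i + j = k) (n : ℕ) (x : E i) {y : E j}
    (hy : y ∈ lowerCentral E n j) : bracket h x y ∈ lowerCentral E (n + 1) k := by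
  rcases n with _ | n
  · exact Submodule.mem_top
  · exact Submodule.subset_span ⟨i, j, h, x, y, hy, rfl⟩

theorem bracket_mem_lowerCentral_left {i j k : ℕ} (h : i + j = k) (n : ℕ) {x : E i} (y : E j)
    (hx : x ∈ lowerCentral E n i) : bracket h x y ∈ lowerCentral E (n + 1) k := by
  rw [antisymm h ((add_comm j i).trans h)]
  exact Submodule.neg_mem _ (Submodule.smul_mem _ _ (bracket_mem_lowerCentral_right _ n y hx))

/-- By Jacobi, `[[s, t], y]` is a combination of `[s, [t, y]]` and `[t, [s, y]]`, each two steps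
deeper than `y`. -/
theorem bracket_mem_lowerCentral_two_left {i j k : ℕ} (h : i + j = k) (n : ℕ) {x : E i} {y : E j}
    (hx : x ∈ lowerCentral E 2 i) (hy : y ∈ lowerCentral E n j) :
    bracket h x y ∈ lowerCentral E (n + 2) k := by
  have hx' : x ∈ Submodule.span ℚ {z | ∃ (a b : ℕ) (h : a + b = i) (u : E a) (v : E b),
      v ∈ lowerCentral E 1 b ∧ bracket h u v = z} := hx
  clear hx
  induction hx' using Submodule.span_induction with
  | mem x hx =>
    obtain ⟨a, b, hab, s, t, -, rfl⟩ := hx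
    have := jacobi (E := E) hab (rfl : b + j = b + j) (rfl : a + j = a + j)
      (show a + (b + j) = k by omega) h (show b + (a + j) = k by omega) s t y
    rw [← sub_eq_iff_eq_add] at this
    rw [← this]
    refine sub_mem ?_ (Submodule.smul_mem _ _ ?_)
    · exact bracket_mem_lowerCentral_right _ _ _ (bracket_mem_lowerCentral_right _ _ _ hy)
    · exact bracket_mem_lowerCentral_right _ _ _ (bracket_mem_lowerCentral_right _ _ _ hy)
  | zero => simp
  | add x x' _ _ hx hx' =>
    rw [map_add, LinearMap.add_apply]
    exact add_mem hx hx'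
  | smul c x _ hx =>
    rw [map_smul, LinearMap.smul_apply]
    exact Submodule.smul_mem _ _ hx

theorem exists_fg_sup_of_quotient_finite {M : Type*} [AddCommGroup M] [Module ℚ M]
    (N : Submodule ℚ M) [FiniteDimensional ℚ (M ⧸ N)] : ∃ F : Submodule ℚ M, F.FG ∧ F ⊔ N = ⊤ := by
  obtain ⟨C, hC⟩ := N.exists_isCompl
  have : Module.Finite ℚ C := Module.Finite.equiv (Submodule.quotientEquivOfIsCompl N C hC)
  exact ⟨C, Module.Finite.iff_fg.1 this, hC.symm.sup_eq_top⟩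

theorem quotient_finite_of_fg_sup {M : Type*} [AddCommGroup M] [Module ℚ M]
    {N F : Submodule ℚ M} (hF : F.FG) (h : F ⊔ N = ⊤) : FiniteDimensional ℚ (M ⧸ N) := by
  refine ⟨?_⟩
  have : F.map N.mkQ = ⊤ := by
    have := congrArg (Submodule.map N.mkQ) h
    rwa [Submodule.map_sup, Submodule.mkQ_map_self, sup_bot_eq, Submodule.map_top,
      Submodule.range_mkQ] at this
  rw [← this]
  exact hF.map _

/-- Modulo `E^{n+2}`, a bracket `[x, y]` with `y ∈ E^n` depends only on `x` modulo `E^2` and `y`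
modulo `E^{n+1}`. So finite sets of representatives for these give finitely many spanning brackets;
since degrees are nonnegative, only finitely many bidegrees add up to `p`. -/
theorem exists_fg_lowerCentral_le (hfin : AbelianizationFiniteType E) (n p : ℕ) :
    ∃ F : Submodule ℚ (E p), F.FG ∧ lowerCentral E n p ≤ F ⊔ lowerCentral E (n + 1) p := by
  rcases n with _ | n
  · exact ⟨⊥, Submodule.fg_bot, le_sup_right⟩
  induction n generalizing p with
  | zero =>
    have := hfin p
    obtain ⟨F, hF, h⟩ := exists_fg_sup_of_quotient_finite (lowerCentral E 2 p)
    exact ⟨F, hF, h ▸ le_top⟩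
  | succ n ih =>
    have h1 : ∀ p, ∃ F : Submodule ℚ (E p), F.FG ∧ F ⊔ lowerCentral E 2 p = ⊤ := fun p =>
      have := hfin p
      exists_fg_sup_of_quotient_finite (lowerCentral E 2 p)
    choose A hA hA' using h1
    choose B hB hB' using ih
    let F : Submodule ℚ (E p) := ⨆ ij : Finset.HasAntidiagonal.antidiagonal p,
      Submodule.map₂ (bracket (Finset.HasAntidiagonal.mem_antidiagonal.1 ij.2)) (A ij.1.1) (B ij.1.2)
    refine ⟨F, Submodule.fg_iSup _ fun ij => Submodule.FG.map₂ _ (hA _) (hB _), ?_⟩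
    rw [lowerCentral, Submodule.span_le]
    rintro z ⟨i, j, h, x, y, hy, rfl⟩
    obtain ⟨a, ha, x', hx', rfl⟩ := Submodule.mem_sup.1 ((hA' i).symm ▸ Submodule.mem_top :
      x ∈ A i ⊔ lowerCentral E 2 i)
    obtain ⟨b, hb, y', hy', rfl⟩ := Submodule.mem_sup.1 (hB' j hy)
    have e : bracket h (a + x') (b + y') =
        bracket h a b + (bracket h a y' + bracket h x' (b + y')) := by
      simp only [map_add, LinearMap.add_apply]
      abel
    rw [e]
    refine Submodule.add_mem_sup ?_ (add_mem ?_ ?_)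
    · exact Submodule.mem_iSup_of_mem (⟨(i, j), Finset.HasAntidiagonal.mem_antidiagonal.2 h⟩ :
        Finset.HasAntidiagonal.antidiagonal p) (Submodule.apply_mem_map₂ _ ha hb)
    · exact bracket_mem_lowerCentral_right _ _ _ hy'
    · exact bracket_mem_lowerCentral_two_left _ _ hx' hy

theorem finiteDimensional_quotient_lowerCentral (hfin : AbelianizationFiniteType E) (n p : ℕ) :
    FiniteDimensional ℚ (E p ⧸ lowerCentral E n p) := by
  suffices h : ∃ F : Submodule ℚ (E p), F.FG ∧ F ⊔ lowerCentral E n p = ⊤ by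
    obtain ⟨F, hF, h⟩ := h
    exact quotient_finite_of_fg_sup hF h
  induction n with
  | zero => exact ⟨⊥, Submodule.fg_bot, bot_sup_eq _⟩
  | succ n ih =>
    obtain ⟨F, hF, h⟩ := ih
    obtain ⟨G, hG, h'⟩ := exists_fg_lowerCentral_le hfin n p
    refine ⟨F ⊔ G, hF.sup hG, top_unique ?_⟩
    rw [← h, sup_assoc]
    exact sup_le_sup_left h' F

end LowerCentral

/-! ### Duality between a pronilpotent Lie algebra and its continuous dual -/

section ContinuousDual

variable (E : ℕ → Type u) [∀ p, AddCommGroup (E p)] [∀ p, Module ℚ (E p)] [GrLieAlgebra E]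

/-- The functionals on `E_p` which vanish on some `E^n`. -/
def continuousDual (p : ℕ) : Submodule ℚ (Module.Dual ℚ (E p)) where
  carrier := {w | ∃ n, w ∈ (lowerCentral E n p).dualAnnihilator}
  zero_mem' := ⟨0, zero_mem _⟩
  add_mem' := by
    rintro v w ⟨m, hm⟩ ⟨n, hn⟩
    exact ⟨max m n, add_mem
      (Submodule.dualAnnihilator_anti (lowerCentral_anti E p (le_max_left m n)) hm)
      (Submodule.dualAnnihilator_anti (lowerCentral_anti E p (le_max_right m n)) hn)⟩
  smul_mem' := by
    rintro c w ⟨n, hn⟩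
    exact ⟨n, Submodule.smul_mem _ c hn⟩

/-- Evaluation `E_p → (continuousDual E p)^∨`. -/
def evaluation (p : ℕ) : E p →ₗ[ℚ] Module.Dual ℚ (continuousDual E p) :=
  (continuousDual E p).subtype.dualMap ∘ₗ Module.Dual.eval ℚ (E p)

variable {E}

theorem mem_lowerCentral_of_dualAnnihilator {n p : ℕ} {x : E p}
    (h : ∀ w ∈ (lowerCentral E n p).dualAnnihilator, w x = 0) : x ∈ lowerCentral E n p := by
  rw [← Subspace.dualAnnihilator_dualCoannihilator_eq (W := lowerCentral E n p),
    Submodule.mem_dualCoannihilator]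
  exact h

/-- A subspace is the common kernel of the functionals that vanish on it, so an element killed by
the continuous dual lies in every `E^n`. -/
theorem evaluation_injective (hpro : IsPronilpotent E) (p : ℕ) :
    Function.Injective (evaluation E p) := by
  rw [injective_iff_map_eq_zero]
  intro x hx
  refine (injective_iff_map_eq_zero _).1 (hpro p).1 x (Subtype.ext (funext fun n => ?_))
  refine (Submodule.Quotient.mk_eq_zero _).2 (mem_lowerCentral_of_dualAnnihilator fun w hw => ?_)
  exact LinearMap.congr_fun hx ⟨w, n, hw⟩

/-- Finite dimensionality makes each `E_p/E^n` reflexive, so `φ` restricted to its dual is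
evaluation at some `a n`. The `a n` are compatible and come from one `x` by pronilpotence. -/
theorem evaluation_surjective (hpro : IsPronilpotent E) (hfin : AbelianizationFiniteType E)
    (p : ℕ) : Function.Surjective (evaluation E p) := by
  intro φ
  have hg : ∀ n (g : Module.Dual ℚ (E p ⧸ lowerCentral E n p)),
      g ∘ₗ (lowerCentral E n p).mkQ ∈ continuousDual E p := fun n g => by
    refine ⟨n, (Submodule.mem_dualAnnihilator _).2 fun x hx => ?_⟩
    rw [LinearMap.comp_apply, Submodule.mkQ_apply, (Submodule.Quotient.mk_eq_zero _).2 hx, map_zero]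
  have ha : ∀ n, ∃ a : E p ⧸ lowerCentral E n p, ∀ g : Module.Dual ℚ (E p ⧸ lowerCentral E n p),
      φ ⟨g ∘ₗ (lowerCentral E n p).mkQ, hg n g⟩ = g a := by
    intro n
    have := finiteDimensional_quotient_lowerCentral hfin n p
    let ψ : Module.Dual ℚ (Module.Dual ℚ (E p ⧸ lowerCentral E n p)) :=
      φ ∘ₗ LinearMap.codRestrict (continuousDual E p) (lowerCentral E n p).mkQ.dualMap (hg n)
    obtain ⟨a, ha⟩ := (Module.evalEquiv ℚ (E p ⧸ lowerCentral E n p)).surjective ψ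
    exact ⟨a, fun g => (LinearMap.congr_fun ha g).symm⟩
  choose a ha using ha
  have hcomp : a ∈ invLimit E p := by
    intro m n h
    rw [← sub_eq_zero, ← Module.forall_dual_apply_eq_zero_iff ℚ]
    intro g
    rw [map_sub, ← ha m g, sub_eq_zero]
    refine (ha n (g ∘ₗ Submodule.factor (lowerCentral_anti E p h))).symm.trans ?_
    rfl
  obtain ⟨x, hx⟩ := (hpro p).2 ⟨a, hcomp⟩
  refine ⟨x, LinearMap.ext ?_⟩
  rintro ⟨w, n, hw⟩
  have hxn : (lowerCentral E n p).mkQ x = a n := congrFun (congrArg Subtype.val hx) n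
  have hw' : lowerCentral E n p ≤ LinearMap.ker w := fun y hy =>
    (Submodule.mem_dualAnnihilator _).1 hw y hy
  have h := ha n ((lowerCentral E n p).liftQ w hw')
  rw [← hxn] at h
  have e : (⟨_, hg n ((lowerCentral E n p).liftQ w hw')⟩ : continuousDual E p) = ⟨w, n, hw⟩ :=
    Subtype.ext (Submodule.liftQ_mkQ _ _ _)
  rw [e] at h
  exact h.symm

/-- The suspension isomorphism `E_p ≅ (continuousDual E p)^∨`. -/
def evaluationEquiv (hpro : IsPronilpotent E) (hfin : AbelianizationFiniteType E) (p : ℕ) :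
    E p ≃ₗ[ℚ] Module.Dual ℚ (continuousDual E p) :=
  LinearEquiv.ofBijective (evaluation E p)
    ⟨evaluation_injective hpro p, evaluation_surjective hpro hfin p⟩

/-- Expand `x` modulo `E^m` in a finite basis with representatives `e k`; the error contributes
nothing, as its brackets lie in `E^{m+1}`. The coordinates serve as `a k` and `w [e k, -]` as `b k`.
-/
theorem exists_bracket_decomposition (hfin : AbelianizationFiniteType E) {p q r m : ℕ}
    (h : p + q = r) {w : Module.Dual ℚ (E r)} (hw : w ∈ (lowerCentral E (m + 1) r).dualAnnihilator) :
    ∃ (N : ℕ) (a : Fin N → Module.Dual ℚ (E p)) (b : Fin N → Module.Dual ℚ (E q)),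
      (∀ k, a k ∈ (lowerCentral E m p).dualAnnihilator) ∧
      (∀ k, b k ∈ (lowerCentral E m q).dualAnnihilator) ∧
      ∀ x y, w (bracket h x y) = ∑ k, a k x * b k y := by
  have := finiteDimensional_quotient_lowerCentral hfin m p
  let β := Module.finBasis ℚ (E p ⧸ lowerCentral E m p)
  choose e he using fun k => (lowerCentral E m p).mkQ_surjective (β k)
  rw [Submodule.mem_dualAnnihilator] at hw
  refine ⟨_, fun k => β.coord k ∘ₗ (lowerCentral E m p).mkQ, fun k => w ∘ₗ bracket h (e k),
    fun k => ?_, fun k => ?_, fun x y => ?_⟩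
  · refine (Submodule.mem_dualAnnihilator _).2 fun x hx => ?_
    rw [LinearMap.comp_apply, Submodule.mkQ_apply, (Submodule.Quotient.mk_eq_zero _).2 hx, map_zero]
  · exact (Submodule.mem_dualAnnihilator _).2 fun y hy =>
      hw _ (bracket_mem_lowerCentral_right _ _ _ hy)
  · have hx : x - ∑ k, β.repr ((lowerCentral E m p).mkQ x) k • e k ∈ lowerCentral E m p := by
      rw [← Submodule.Quotient.mk_eq_zero, ← Submodule.mkQ_apply, map_sub, map_sum]
      simp only [map_smul, he]
      rw [β.sum_repr, sub_self]
    have := hw _ (bracket_mem_lowerCentral_left h _ y hx)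
    rw [map_sub, LinearMap.sub_apply, map_sub, sub_eq_zero] at this
    rw [this]
    simp [map_sum, LinearMap.sum_apply]

end ContinuousDual

end GrLieAlgebra

/-! ### Differentials of degree one on the free algebra -/

namespace FreeCGA

variable {V : ℕ → Type u} [∀ p, AddCommGroup (V p)] [∀ p, Module ℚ (V p)]

theorem neg_one_pow_eq_ite (n : ℕ) : (-1 : ℚ) ^ n = if Even n then 1 else -1 := by
  split_ifs with h
  · exact h.neg_one_pow
  · exact (Nat.not_even_iff_odd.1 h).neg_one_pow

/-- The extension of a linear map `θ : V → ΛV` of degree `1` to a derivation. -/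
def differential (θ : (⨁ p, V p) →ₗ[ℚ] FreeCGA V)
    (hθ : ∀ i (v : V i), θ (DirectSum.lof ℚ ℕ V i v) ∈ degree V (i + 1)) :
    FreeCGA V →ₗ[ℚ] FreeCGA V :=
  derivation 1 θ fun i j v w => by
    rw [gen_mul_degree i (j + 1) v (hθ j w), gen_mul_degree j (i + 1) w (hθ i v)]
    match_scalars <;> simp only [neg_one_pow_eq_ite, Nat.even_mul, Nat.even_add, Nat.not_even_one] <;>
      by_cases hi : Even i <;> by_cases hj : Even j <;> simp [hi, hj]

section Differential

variable (θ : (⨁ p, V p) →ₗ[ℚ] FreeCGA V)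
    (hθ : ∀ i (v : V i), θ (DirectSum.lof ℚ ℕ V i v) ∈ degree V (i + 1))

theorem differential_ι (x : ⨁ p, V p) : differential θ hθ (ι V x) = θ x := derivation_ι _ _ _ _

theorem isDerivation_differential : IsDerivation 1 (differential θ hθ) :=
  isDerivation_derivation _ _ _ fun δ i v => by rw [sgn_degree δ (hθ i v), add_comm 1 i]

theorem differential_mem_degree {n : ℕ} {a : FreeCGA V} (ha : a ∈ degree V n) :
    differential θ hθ a ∈ degree V (n + 1) := by
  refine degree_induction (C := fun n a => differential θ hθ a ∈ degree V (n + 1))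
    ?_ ?_ ?_ ?_ ?_ ha
  · rw [(isDerivation_differential θ hθ).map_one]
    exact zero_mem _
  · intro n
    rw [map_zero]
    exact zero_mem _
  · intro n a b ha hb
    rw [map_add]
    exact add_mem ha hb
  · intro n c a ha
    rw [map_smul]
    exact Submodule.smul_mem _ c ha
  · intro i n v a ha h
    rw [(isDerivation_differential θ hθ).map_gen_mul]
    refine add_mem ?_ (Submodule.smul_mem _ _ ?_)
    · have := mul_mem_degree (hθ i v) ha
      rw [← ι_lof, differential_ι]
      rwa [add_right_comm] at this
    · have := mul_mem_degree (gen_mem_degree i v) h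
      rwa [← add_assoc] at this

theorem differential_mem_wedge_three (hw : ∀ x, θ x ∈ wedge V 2) {a : FreeCGA V}
    (ha : a ∈ wedge V 2) : differential θ hθ a ∈ wedge V 3 := by
  refine wedge_two_induction (C := fun a => differential θ hθ a ∈ wedge V 3) (fun x y => ?_)
    (fun a b ha hb => ?_) ha
  · rw [(isDerivation_differential θ hθ).map_mul, differential_ι, differential_ι]
    exact add_mem (mul_mem_wedge (hw x) (ι_mem_wedge y))
      (mul_mem_wedge (sgn_ι_mem_wedge 1 x) (hw y))
  · rw [map_add]
    exact add_mem ha hb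

/-- For odd `d` the graded commutator of `d` with itself is `2d²`, so half of it is again a
derivation and `d² = 0` need only be tested on generators. -/
theorem isDerivation_differential_differential :
    IsDerivation 2 (differential θ hθ ∘ₗ differential θ hθ) := by
  have h := ((isDerivation_differential θ hθ).commutator
    (isDerivation_differential θ hθ)).smul (1 / 2)
  have e : (1 / 2 : ℚ) • (differential θ hθ ∘ₗ differential θ hθ +
      (-(-1 : ℚ) ^ (1 * 1)) • differential θ hθ ∘ₗ differential θ hθ) =
      differential θ hθ ∘ₗ differential θ hθ := by
    match_scalars
    norm_num
  rwa [e] at h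

end Differential

theorem contraction_zero (p : ℕ) : contraction (0 : Module.Dual ℚ (V p)) = 0 :=
  (isDerivation_contraction _).ext (IsDerivation.zero p) fun i v => by
    rw [← ι_lof, contraction_ι]
    simp

theorem sub_mem_wedge {k : ℕ} {a b : FreeCGA V} (ha : a ∈ wedge V k) (hb : b ∈ wedge V k) :
    a - b ∈ wedge V k := by
  have h := add_mem ha (Submodule.smul_mem _ (-1) hb)
  have e : a + (-1 : ℚ) • b = a - b := by
    rw [Algebra.smul_def, map_neg, map_one, neg_one_mul, sub_eq_add_neg]
  rwa [e] at h

end FreeCGA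

/-! ### Cobrackets, and the vanishing of the squared differential by the Jacobi identity -/

namespace GrLieAlgebra

open FreeCGA

variable {E : ℕ → Type w} [∀ p, AddCommGroup (E p)] [∀ p, Module ℚ (E p)]
  {V : ℕ → Type u} [∀ p, AddCommGroup (V p)] [∀ p, Module ℚ (V p)]
  (s : ∀ p, E p ≃ₗ[ℚ] Module.Dual ℚ (V (p + 1)))

-- Every contraction is of the form used here: `s` is onto the dual in positive degrees, and degree
-- 0 of `V` is zero.
include s in
theorem eq_zero_of_suspension [Subsingleton (V 0)] {k : ℕ} {a : FreeCGA V}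
    (ha : a ∈ wedge V (k + 1)) (h : ∀ p (x : E p), contraction (s p x) a = 0) : a = 0 := by
  refine eq_zero_of_contraction ha fun p f => ?_
  rcases p with _ | p
  · have : f = 0 := LinearMap.ext fun v => by rw [Subsingleton.elim v 0, map_zero, map_zero]
    rw [this, contraction_zero, LinearMap.zero_apply]
  · obtain ⟨x, rfl⟩ := (s p).surjective f
    exact h p x

variable [GrLieAlgebra E]

/-- `Φ ∈ Λ²V` is dual to the bracket of `E`, evaluated at `x ∈ V`. -/
structure IsCobracket (x : ⨁ p, V p) (Φ : FreeCGA V) : Prop where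
  mem_wedge : Φ ∈ wedge V 2
  contraction_eq : ∀ {p q r : ℕ} (h : p + q = r) (y : E p) (z : E q),
    contraction (s p y) (contraction (s q z) Φ) =
      algebraMap ℚ _ ((-1) ^ (q + 1) * s r (bracket h y z) (x (r + 1)))

variable {s}

namespace IsCobracket

theorem zero : IsCobracket s 0 0 := ⟨zero_mem _, by simp⟩

theorem add {x x' : ⨁ p, V p} {Φ Φ' : FreeCGA V} (h : IsCobracket s x Φ)
    (h' : IsCobracket s x' Φ') : IsCobracket s (x + x') (Φ + Φ') where
  mem_wedge := add_mem h.mem_wedge h'.mem_wedge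
  contraction_eq e y z := by
    rw [map_add, map_add, h.contraction_eq e, h'.contraction_eq e, ← map_add (algebraMap _ _),
      DirectSum.add_apply, map_add (s _ _), mul_add]

theorem smul {x : ⨁ p, V p} {Φ : FreeCGA V} (c : ℚ) (h : IsCobracket s x Φ) :
    IsCobracket s (c • x) (c • Φ) where
  mem_wedge := Submodule.smul_mem _ c h.mem_wedge
  contraction_eq e y z := by
    rw [map_smul, map_smul, h.contraction_eq e, DirectSum.smul_apply, map_smul, smul_eq_mul,
      mul_left_comm, map_mul _ c, Algebra.smul_def]

theorem unique [Subsingleton (V 0)] {x : ⨁ p, V p} {Φ Φ' : FreeCGA V} (h : IsCobracket s x Φ)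
    (h' : IsCobracket s x Φ') : Φ = Φ' := by
  rw [← sub_eq_zero]
  refine eq_zero_of_suspension s (sub_mem_wedge h.mem_wedge h'.mem_wedge) fun q z => ?_
  refine eq_zero_of_suspension s (contraction_mem_wedge _ (sub_mem_wedge h.mem_wedge h'.mem_wedge))
    fun p y => ?_
  rw [map_sub, map_sub, h.contraction_eq rfl, h'.contraction_eq rfl, sub_self]

end IsCobracket

section Square

variable (θ : (⨁ p, V p) →ₗ[ℚ] FreeCGA V)
    (hθ : ∀ i (v : V i), θ (DirectSum.lof ℚ ℕ V i v) ∈ degree V (i + 1))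
    (hc : ∀ x, IsCobracket s x (θ x))

/-- The commutator of the differential with a contraction: the coadjoint action. -/
def coadjoint {p : ℕ} (x : E p) : FreeCGA V →ₗ[ℚ] FreeCGA V :=
  contraction (s p x) ∘ₗ differential θ hθ +
    (-(-1 : ℚ) ^ ((p + 1) * 1)) • differential θ hθ ∘ₗ contraction (s p x)

omit [GrLieAlgebra E] in
theorem isDerivation_coadjoint {p : ℕ} (x : E p) :
    IsDerivation (p + 1 + 1) (coadjoint (s := s) θ hθ x) :=
  (isDerivation_contraction _).commutator (isDerivation_differential θ hθ)

omit [GrLieAlgebra E] in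
theorem coadjoint_ι {p : ℕ} (x : E p) (v : ⨁ p, V p) :
    coadjoint (s := s) θ hθ x (ι V v) = contraction (s p x) (θ v) := by
  rw [coadjoint, LinearMap.add_apply, LinearMap.smul_apply, LinearMap.comp_apply,
    LinearMap.comp_apply, differential_ι, contraction_ι,
    (isDerivation_differential θ hθ).map_algebraMap, smul_zero, add_zero]

-- A Cartan formula: up to sign, the commutator of a contraction with the coadjoint action of `x` is
-- contraction by `[y, x]`. Both sides are derivations of the same parity, so generators suffice,
-- and there the formula is the definition of a cobracket.
include hc in
theorem contraction_coadjoint {p q r : ℕ} (h : q + p = r) (x : E p) (y : E q) (a : FreeCGA V) :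
    contraction (s q y) (coadjoint (s := s) θ hθ x a) =
      (-1 : ℚ) ^ (p + 1) • contraction (s r (bracket h y x)) a +
        (-1 : ℚ) ^ ((q + 1) * p) • coadjoint (s := s) θ hθ x (contraction (s q y) a) := by
  have h1 := (isDerivation_contraction (s q y)).commutator (isDerivation_coadjoint (s := s) θ hθ x)
  have e : q + 1 + (p + 1 + 1) = r + 1 + 2 := by omega
  rw [e] at h1
  have h2 := h1.of_add_two.ext
    ((isDerivation_contraction (s r (bracket h y x))).smul ((-1 : ℚ) ^ (p + 1))) fun i v => by
      rw [← ι_lof, LinearMap.add_apply, LinearMap.smul_apply, LinearMap.comp_apply,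
        LinearMap.comp_apply, coadjoint_ι, contraction_ι,
        (isDerivation_coadjoint (s := s) θ hθ x).map_algebraMap, smul_zero, add_zero,
        (hc _).contraction_eq h, LinearMap.smul_apply, contraction_ι, map_mul, Algebra.smul_def]
  have h3 := LinearMap.congr_fun h2 a
  rw [LinearMap.add_apply, LinearMap.smul_apply, LinearMap.comp_apply,
    LinearMap.comp_apply, LinearMap.smul_apply] at h3
  rw [← h3, add_assoc, ← add_smul]
  have : -(-1 : ℚ) ^ ((q + 1) * (p + 1 + 1)) + (-1) ^ ((q + 1) * p) = 0 := by
    have : (q + 1) * (p + 1 + 1) = (q + 1) * p + 2 * (q + 1) := by ring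
    rw [this, pow_add, pow_mul _ 2]
    simp
  rw [this, zero_smul, add_zero]

-- Write contraction after `d` as the coadjoint action plus a signed `d` after contraction, then
-- move the second contraction through by the Cartan formula. It is applied to `a = θ v`, whose
-- contractions are linear.
include hc in
theorem contraction_contraction_differential {p q r : ℕ} (h : q + p = r) (x : E p) (y : E q)
    {a : FreeCGA V} {vx vy : ⨁ p, V p} (hx : contraction (s p x) a = ι V vx)
    (hy : contraction (s q y) a = ι V vy) :
    contraction (s q y) (contraction (s p x) (differential θ hθ a)) =
      (-1 : ℚ) ^ (p + 1) • contraction (s r (bracket h y x)) a +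
        (-1 : ℚ) ^ ((q + 1) * p) • contraction (s p x) (θ vy) +
        (-1 : ℚ) ^ (p + 1) • contraction (s q y) (θ vx) := by
  have h1 : contraction (s p x) (differential θ hθ a) =
      coadjoint (s := s) θ hθ x a + (-1 : ℚ) ^ (p + 1) • θ vx := by
    rw [coadjoint, LinearMap.add_apply, LinearMap.smul_apply, LinearMap.comp_apply,
      LinearMap.comp_apply, hx, differential_ι, mul_one, add_assoc, ← add_smul,
      neg_add_cancel, zero_smul, add_zero]
  rw [h1, map_add, map_smul, contraction_coadjoint θ hθ hc h, hy, coadjoint_ι]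

-- The element lies in `Λ³V`, so three contractions turn it into a scalar. That scalar is a signed
-- sum of the values of `v` on three iterated brackets of `z`, `y`, `x`.
include hc in
theorem differential_differential_ι [Subsingleton (V 0)] (v : ⨁ p, V p) :
    differential θ hθ (θ v) = 0 := by
  have hw : ∀ x, θ x ∈ wedge V 2 := fun x => (hc x).mem_wedge
  have h3 := differential_mem_wedge_three θ hθ hw (hw v)
  refine eq_zero_of_suspension s h3 fun p x => ?_
  refine eq_zero_of_suspension s (contraction_mem_wedge _ h3) fun q y => ?_
  refine eq_zero_of_suspension s (contraction_mem_wedge _ (contraction_mem_wedge _ h3)) fun t z => ?_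
  have h1 : ∀ {p} (x : E p), ∃ vx, contraction (s p x) (θ v) = ι V vx := fun x => by
    have := contraction_mem_wedge (s _ x) (hw v)
    rw [wedge_one] at this
    obtain ⟨vx, hvx⟩ := this
    exact ⟨vx, hvx.symm⟩
  have h2 : ∀ {a b c : ℕ} (h : a + b = c) (y : E a) (z : E b) (vz : ⨁ p, V p),
      contraction (s b z) (θ v) = ι V vz →
      s a y (vz (a + 1)) = (-1) ^ (b + 1) * s c (bracket h y z) (v (c + 1)) := by
    intro a b c h y z vz hz
    have := (hc v).contraction_eq h y z
    rw [hz, contraction_ι] at this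
    exact algebraMap_injective this
  obtain ⟨vx, hx⟩ := h1 x
  obtain ⟨vy, hy⟩ := h1 y
  rw [contraction_contraction_differential θ hθ hc rfl x y hx hy, map_add, map_add, map_smul,
    map_smul, map_smul, (hc v).contraction_eq (rfl : t + (q + p) = t + (q + p)),
    (hc vy).contraction_eq (rfl : t + p = t + p), (hc vx).contraction_eq (rfl : t + q = t + q),
    h2 (show t + p + q = t + (q + p) by omega) _ y vy hy,
    h2 (show t + q + p = t + (q + p) by omega) _ x vx hx,
    -- Jacobi and antisymmetry express `[z, [y, x]]` through `[[z, y], x]` and `[[z, x], y]`, the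
    -- brackets in the other two terms. The coefficients of these two values then cancel, parity by
    -- parity.
    jacobi (rfl : t + q = t + q) (rfl : q + p = q + p) (rfl : t + p = t + p) rfl
      (show t + q + p = t + (q + p) by omega) (show q + (t + p) = t + (q + p) by omega) z y x,
    antisymm (show q + (t + p) = t + (q + p) by omega) (show t + p + q = t + (q + p) by omega) y]
  simp only [map_add, map_neg, map_smul, LinearMap.add_apply, LinearMap.neg_apply,
    LinearMap.smul_apply, smul_eq_mul, Algebra.smul_def]
  simp only [← map_mul, ← map_add]
  rw [← map_zero (algebraMap ℚ (FreeCGA V))]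
  congr 1
  generalize s (t + (q + p)) _ _ = A
  generalize s (t + (q + p)) _ _ = B
  simp only [neg_one_pow_eq_ite, Nat.even_mul, Nat.even_add, Nat.not_even_one]
  by_cases hp : Even p <;> by_cases hq : Even q <;> by_cases ht : Even t <;> simp [hp, hq, ht]

include hc in
theorem differential_differential [Subsingleton (V 0)] (a : FreeCGA V) :
    differential θ hθ (differential θ hθ a) = 0 := by
  have := (isDerivation_differential_differential θ hθ).ext (IsDerivation.zero 2) fun i v => by
    rw [LinearMap.comp_apply, ← ι_lof, differential_ι, differential_differential_ι θ hθ hc,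
      LinearMap.zero_apply]
  exact LinearMap.congr_fun this a

end Square

end GrLieAlgebra

/-! ### Construction of the quadratic Sullivan algebra -/

namespace GrLieAlgebra

open FreeCGA

section Construction

variable {E : ℕ → Type w} [∀ p, AddCommGroup (E p)] [∀ p, Module ℚ (E p)]
  {V : ℕ → Type u} [∀ p, AddCommGroup (V p)] [∀ p, Module ℚ (V p)]
  (s : ∀ p, E p ≃ₗ[ℚ] Module.Dual ℚ (V (p + 1))) [GrLieAlgebra E]

/-- The elements of `V` whose components vanish on `E^n`. -/
def annihilator (n : ℕ) : Submodule ℚ (⨁ p, V p) where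
  carrier := {v | ∀ p, ∀ x ∈ lowerCentral E n p, s p x (v (p + 1)) = 0}
  zero_mem' := fun p x _ => by simp
  add_mem' := fun {v w} hv hw p x hx => by
    rw [DirectSum.add_apply, map_add, hv p x hx, hw p x hx, add_zero]
  smul_mem' := fun c v hv p x hx => by
    rw [DirectSum.smul_apply, map_smul, hv p x hx, smul_zero]

theorem annihilator_mono : Monotone (annihilator s) := fun _ _ h _ hv p x hx =>
  hv p x (lowerCentral_anti E p h hx)

theorem lof_mem_annihilator {n r : ℕ} {v : V (r + 1)}
    (hv : ∀ x ∈ lowerCentral E n r, s r x v = 0) :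
    DirectSum.lof ℚ ℕ V (r + 1) v ∈ annihilator s n := by
  intro p x hx
  by_cases h : r = p
  · subst h
    rw [lof_apply_self]
    exact hv x hx
  · rw [lof_apply_of_ne v (by omega), map_zero]

/-- `V^{p+1}` consists of all functionals on `E_p` which vanish on some `E^n`. -/
structure IsContinuousDual : Prop where
  exists_annihilates : ∀ {p : ℕ} (v : V (p + 1)), ∃ n, ∀ x ∈ lowerCentral E n p, s p x v = 0
  exists_eq : ∀ {n p : ℕ} (f : Module.Dual ℚ (E p)), f ∈ (lowerCentral E n p).dualAnnihilator →
    ∃ v : V (p + 1), ∀ x, s p x v = f x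

variable {s}

theorem IsContinuousDual.exists_mem_annihilator [Subsingleton (V 0)] (hs : IsContinuousDual s)
    (v : ⨁ p, V p) : ∃ n, v ∈ annihilator s n := by
  induction v using DirectSum.induction_on with
  | zero => exact ⟨0, zero_mem _⟩
  | of i v =>
    rcases i with _ | r
    · refine ⟨0, ?_⟩
      rw [Subsingleton.elim v 0, map_zero]
      exact zero_mem _
    · obtain ⟨n, hn⟩ := hs.exists_annihilates v
      exact ⟨n, lof_mem_annihilator s hn⟩
  | add v w hv hw =>
    obtain ⟨m, hm⟩ := hv
    obtain ⟨n, hn⟩ := hw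
    exact ⟨max m n, add_mem (annihilator_mono s (le_max_left m n) hm)
      (annihilator_mono s (le_max_right m n) hn)⟩

/-- The pairing of an elementary term of the cobracket. -/
theorem sum_suspension_mul {r i j N : ℕ} (hij : i + j = r) {v : V (r + 1)}
    {a : Fin N → V (i + 1)} {b : Fin N → V (j + 1)}
    (hab : ∀ x y, s r (bracket hij x y) v = ∑ k, s i x (a k) * s j y (b k))
    {p q : ℕ} (x : E p) (y : E q) :
    ∑ k, s p x (DirectSum.lof ℚ ℕ V (i + 1) (a k) (p + 1)) *
        s q y (DirectSum.lof ℚ ℕ V (j + 1) (b k) (q + 1)) =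
      if (i, j) = (p, q) then
        s (p + q) (bracket rfl x y) (DirectSum.lof ℚ ℕ V (r + 1) v (p + q + 1)) else 0 := by
  split_ifs with h
  · obtain ⟨rfl, rfl⟩ := Prod.mk.inj h
    subst hij
    simp only [lof_apply_self, hab]
  · refine Finset.sum_eq_zero fun k _ => ?_
    by_cases hi : i = p
    · have hj : j + 1 ≠ q + 1 := fun hj => h (by rw [hi, Nat.succ.inj hj])
      rw [lof_apply_of_ne (b k) hj, map_zero, mul_zero]
    · rw [lof_apply_of_ne (a k) (by omega), map_zero, zero_mul]

/-- Decompose `v [-, -]` in every bidegree `(i, j)` with `i + j = r` and add the signed products `b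
k ∧ a k`. Degree and filtration can be read off this explicit element; uniqueness later carries them
to the chosen cobracket. -/
theorem IsContinuousDual.exists_isCobracket_lof (hs : IsContinuousDual s)
    (hfin : AbelianizationFiniteType E) {r m : ℕ} {v : V (r + 1)}
    (hv : ∀ x ∈ lowerCentral E (m + 1) r, s r x v = 0) :
    ∃ Φ, IsCobracket s (DirectSum.lof ℚ ℕ V (r + 1) v) Φ ∧ Φ ∈ degree V (r + 1 + 1) ∧
      Φ ∈ Algebra.adjoin ℚ (ι V '' (annihilator s m : Set (⨁ p, V p))) := by
  have hdec : ∀ ij : ℕ × ℕ, ∃ (N : ℕ) (a : Fin N → V (ij.1 + 1)) (b : Fin N → V (ij.2 + 1)),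
      (∀ k, DirectSum.lof ℚ ℕ V _ (a k) ∈ annihilator s m) ∧
      (∀ k, DirectSum.lof ℚ ℕ V _ (b k) ∈ annihilator s m) ∧
      ∀ (h : ij.1 + ij.2 = r) x y,
        s r (bracket h x y) v = ∑ k, s ij.1 x (a k) * s ij.2 y (b k) := by
    rintro ⟨i, j⟩
    by_cases h : i + j = r
    · obtain ⟨N, a, b, ha, hb, hab⟩ := exists_bracket_decomposition hfin h
        (w := (s r).toLinearMap.flip v) (m := m) ((Submodule.mem_dualAnnihilator _).2 hv)
      choose a' ha' using fun k => hs.exists_eq (a k) (ha k)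
      choose b' hb' using fun k => hs.exists_eq (b k) (hb k)
      refine ⟨N, a', b', fun k => lof_mem_annihilator s fun x hx => ?_,
        fun k => lof_mem_annihilator s fun x hx => ?_, fun _ x y => ?_⟩
      · rw [ha']
        exact (Submodule.mem_dualAnnihilator _).1 (ha k) x hx
      · rw [hb']
        exact (Submodule.mem_dualAnnihilator _).1 (hb k) x hx
      · simp only [ha', hb']
        exact hab x y
    -- Off the antidiagonal an empty family is a harmless default, never summed below.
    · exact ⟨0, Fin.elim0, Fin.elim0, fun k => k.elim0, fun k => k.elim0, fun h' => absurd h' h⟩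
  choose N a b ha hb hab using hdec
  let T : ℕ × ℕ → FreeCGA V := fun ij => (-1 : ℚ) ^ (ij.2 + 1) •
    ∑ k, gen V (ij.2 + 1) (b ij k) * gen V (ij.1 + 1) (a ij k)
  -- The sum runs over ordered bidegrees, and `(p, q)` and `(q, p)` contribute equally by
  -- antisymmetry of the bracket; hence the factor 1/2. When `p = q` the two contributions come from
  -- one and the same term.
  refine ⟨(1 / 2 : ℚ) • ∑ ij ∈ Finset.HasAntidiagonal.antidiagonal r, T ij, ⟨?_, ?_⟩, ?_, ?_⟩
  · exact Submodule.smul_mem _ _ (Submodule.sum_mem _ fun ij _ => Submodule.smul_mem _ _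
      (Submodule.sum_mem _ fun k _ => mul_mem_wedge (gen_mem_wedge _ _) (gen_mem_wedge _ _)))
  · rintro p q _ rfl x y
    set A := s (p + q) (bracket rfl x y) (DirectSum.lof ℚ ℕ V (r + 1) v (p + q + 1)) with hA
    have hA' : s (q + p) (bracket rfl y x) (DirectSum.lof ℚ ℕ V (r + 1) v (q + p + 1)) =
        -((-1) ^ (p * q) * A) := by
      have e : ∀ (n : ℕ) (h : q + p = n),
          s (q + p) (bracket rfl y x) (DirectSum.lof ℚ ℕ V (r + 1) v (q + p + 1)) =
          s n (bracket h y x) (DirectSum.lof ℚ ℕ V (r + 1) v (n + 1)) := by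
        rintro _ rfl
        rfl
      rw [e (p + q) (add_comm q p), antisymm (add_comm q p) rfl, map_neg, map_smul,
        LinearMap.neg_apply, LinearMap.smul_apply, smul_eq_mul, mul_comm q p]
    have hT : ∀ ij ∈ Finset.HasAntidiagonal.antidiagonal r,
        contraction (s p x) (contraction (s q y) (T ij)) =
          algebraMap ℚ _ ((if ij = (p, q) then (-1) ^ (q + 1) * A else 0) +
            (if ij = (q, p) then (-1) ^ (q + 1) * A else 0)) := by
      rintro ⟨i, j⟩ hij
      rw [Finset.HasAntidiagonal.mem_antidiagonal] at hij
      simp only [T, map_smul, map_sum]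
      simp only [← ι_lof, contraction_contraction_ι_mul_ι]
      have h1 := sum_suspension_mul (s := s) hij (hab (i, j) hij) x y
      have h2 := sum_suspension_mul (s := s) hij (hab (i, j) hij) y x
      rw [← map_sum, Finset.sum_add_distrib, ← Finset.mul_sum, Algebra.smul_def, ← map_mul]
      rw [Finset.sum_congr rfl fun k _ => mul_comm (s q y _) (s p x _), h1, h2, hA', mul_add]
      congr 2
      · split_ifs with h
        · rw [show j = _ from (Prod.mk.inj h).2]
        · exact mul_zero _
      · split_ifs with h
        · rw [show j = _ from (Prod.mk.inj h).2]
          simp only [neg_one_pow_eq_ite, Nat.even_mul, Nat.even_add, Nat.not_even_one]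
          by_cases hp : Even p <;> by_cases hq : Even q <;> simp [hp, hq]
        · rw [mul_zero, mul_zero]
    rw [map_smul, map_smul, map_sum, map_sum, Finset.sum_congr rfl hT, ← map_sum,
      Algebra.smul_def, ← map_mul, Finset.sum_add_distrib, Finset.sum_ite_eq', Finset.sum_ite_eq']
    congr 1
    simp only [Finset.HasAntidiagonal.mem_antidiagonal, add_comm q p]
    split_ifs with h
    · ring
    · rw [hA, lof_apply_of_ne v (by omega), map_zero]
      simp
  · refine Submodule.smul_mem _ _ (Submodule.sum_mem _ fun ij hij => Submodule.smul_mem _ _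
      (Submodule.sum_mem _ fun k _ => ?_))
    have := mul_mem_degree (gen_mem_degree (ij.2 + 1) (b ij k)) (gen_mem_degree (ij.1 + 1) (a ij k))
    rw [Finset.HasAntidiagonal.mem_antidiagonal] at hij
    have e : ij.2 + 1 + (ij.1 + 1) = r + 1 + 1 := by omega
    rwa [e] at this
  · refine Subalgebra.smul_mem _ (Subalgebra.sum_mem _ fun ij _ => Subalgebra.smul_mem _
      (Subalgebra.sum_mem _ fun k _ => Subalgebra.mul_mem _ ?_ ?_) _) _
    · exact Algebra.subset_adjoin ⟨_, hb ij k, rfl⟩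
    · exact Algebra.subset_adjoin ⟨_, ha ij k, rfl⟩

theorem IsContinuousDual.exists_isCobracket [Subsingleton (V 0)] (hs : IsContinuousDual s)
    (hfin : AbelianizationFiniteType E) (m : ℕ) {v : ⨁ p, V p} (hv : v ∈ annihilator s (m + 1)) :
    ∃ Φ, IsCobracket s v Φ ∧ Φ ∈ Algebra.adjoin ℚ (ι V '' (annihilator s m : Set (⨁ p, V p))) := by
  classical
  have key : ∀ F : Finset ℕ, ∃ Φ, IsCobracket s (∑ i ∈ F, DirectSum.lof ℚ ℕ V i (v i)) Φ ∧
      Φ ∈ Algebra.adjoin ℚ (ι V '' (annihilator s m : Set (⨁ p, V p))) := by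
    intro F
    induction F using Finset.induction_on with
    | empty => exact ⟨0, IsCobracket.zero, zero_mem _⟩
    | insert i F hi ih =>
      obtain ⟨Φ, hΦ, hΦ'⟩ := ih
      rw [Finset.sum_insert hi]
      rcases i with _ | r
      · refine ⟨Φ, ?_, hΦ'⟩
        rwa [Subsingleton.elim (v 0) 0, map_zero, zero_add]
      · obtain ⟨Ψ, hΨ, -, hΨ'⟩ := hs.exists_isCobracket_lof hfin (hv r)
        exact ⟨Ψ + Φ, hΨ.add hΦ, Subalgebra.add_mem _ hΨ' hΦ'⟩
  obtain ⟨Φ, hΦ⟩ := key (DFinsupp.support v)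
  have e : ∑ i ∈ DFinsupp.support v, DirectSum.lof ℚ ℕ V i (v i) = v := DirectSum.sum_support_of v
  rw [e] at hΦ
  exact ⟨Φ, hΦ⟩

theorem IsContinuousDual.exists_cobracket [Subsingleton (V 0)] (hs : IsContinuousDual s)
    (hfin : AbelianizationFiniteType E) (v : ⨁ p, V p) : ∃ Φ, IsCobracket s v Φ := by
  obtain ⟨n, hn⟩ := hs.exists_mem_annihilator v
  obtain ⟨Φ, hΦ, -⟩ := hs.exists_isCobracket hfin n (annihilator_mono s n.le_succ hn)
  exact ⟨Φ, hΦ⟩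

variable [Subsingleton (V 0)] (hs : IsContinuousDual s) (hfin : AbelianizationFiniteType E)

/-- The quadratic differential `V → Λ²V` dual to the bracket. -/
def cobracket : (⨁ p, V p) →ₗ[ℚ] FreeCGA V where
  toFun v := (hs.exists_cobracket hfin v).choose
  map_add' v w := (hs.exists_cobracket hfin (v + w)).choose_spec.unique
    ((hs.exists_cobracket hfin v).choose_spec.add (hs.exists_cobracket hfin w).choose_spec)
  map_smul' c v := (hs.exists_cobracket hfin (c • v)).choose_spec.unique
    ((hs.exists_cobracket hfin v).choose_spec.smul c)

theorem isCobracket_cobracket (v : ⨁ p, V p) : IsCobracket s v (cobracket hs hfin v) :=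
  (hs.exists_cobracket hfin v).choose_spec

theorem cobracket_mem_degree (i : ℕ) (v : V i) :
    cobracket hs hfin (DirectSum.lof ℚ ℕ V i v) ∈ degree V (i + 1) := by
  rcases i with _ | r
  · rw [Subsingleton.elim v 0, map_zero, map_zero]
    exact zero_mem _
  · obtain ⟨n, hn⟩ := hs.exists_annihilates v
    obtain ⟨Φ, hΦ, hd, -⟩ := hs.exists_isCobracket_lof hfin (m := n)
      fun x hx => hn x (lowerCentral_succ_le E n r hx)
    rw [(isCobracket_cobracket hs hfin _).unique hΦ]
    exact hd

/-- The shift by 2 comes from the start: functionals vanishing on `E^2` see no brackets, so their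
cobracket is zero. Afterwards, one more power of `E` gives one more stage, since the cobracket is
built from functionals vanishing one step earlier. -/
theorem annihilator_le_sullivanFiltration (n : ℕ) : annihilator s (n + 2) ≤
    sullivanFiltration V (differential (cobracket hs hfin) (cobracket_mem_degree hs hfin)) n := by
  induction n with
  | zero =>
    intro v hv
    rw [sullivanFiltration, LinearMap.mem_ker, LinearMap.comp_apply, differential_ι]
    refine (isCobracket_cobracket hs hfin v).unique ⟨zero_mem _, fun {p q r} h x y => ?_⟩
    rw [hv r _ (bracket_mem_lowerCentral_right h 1 x Submodule.mem_top)]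
    simp
  | succ n ih =>
    intro v hv
    rw [sullivanFiltration, Submodule.mem_comap, LinearMap.comp_apply, differential_ι,
      Subalgebra.mem_toSubmodule]
    obtain ⟨Φ, hΦ, hΦ'⟩ := hs.exists_isCobracket hfin (n + 2) hv
    rw [(isCobracket_cobracket hs hfin v).unique hΦ]
    exact Algebra.adjoin_mono (Set.image_mono ih) hΦ'

/-- The quadratic Sullivan algebra constructed from the bracket of `E`. -/
def cochainAlgebra : LambdaAlgebra.{u} where
  V := V
  d := differential (cobracket hs hfin) (cobracket_mem_degree hs hfin)
  d_degree _ _ ha := differential_mem_degree _ _ ha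
  d_mul n a ha b := by
    rw [(isDerivation_differential _ _).map_mul, sgn_degree 1 ha, one_mul, smul_mul_assoc]
  d_d a := differential_differential _ _ (isCobracket_cobracket hs hfin) a
  sullivan v := by
    obtain ⟨n, hn⟩ := hs.exists_mem_annihilator v
    exact ⟨n, annihilator_le_sullivanFiltration hs hfin n
      (annihilator_mono s (Nat.le_add_right n 2) hn)⟩

theorem isQuadraticSullivan_cochainAlgebra : (cochainAlgebra hs hfin).IsQuadraticSullivan where
  degree_pos := ‹Subsingleton (V 0)›
  quadratic :=
    have key (x : ⨁ p, V p) : differential (cobracket hs hfin) (cobracket_mem_degree hs hfin)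
        (ι V x) ∈ wedge V 2 := by
      rw [differential_ι]
      exact (isCobracket_cobracket hs hfin x).mem_wedge
    key

theorem suspension_bracket_cochainAlgebra {p q r : ℕ} (h : p + q = r) (x : E p) (y : E q)
    (v : V (r + 1)) : s r (bracket h x y) v =
      (-1) ^ (q + 1) * pairing (s p x) (s q y) ((cochainAlgebra hs hfin).d (gen V (r + 1) v)) := by
  change _ = _ * pairing _ _ (differential (cobracket hs hfin) (cobracket_mem_degree hs hfin)
    (ι V (DirectSum.lof ℚ ℕ V (r + 1) v)))
  have hc := isCobracket_cobracket hs hfin (DirectSum.lof ℚ ℕ V (r + 1) v)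
  rw [differential_ι]
  have h1 := contraction_contraction (s p x) (s q y) hc.mem_wedge
  rw [hc.contraction_eq h] at h1
  rw [← algebraMap_injective h1, lof_apply_self, ← mul_assoc, neg_one_pow_mul_self, one_mul]

end Construction

section CochainSpace

variable (E : ℕ → Type u) [∀ p, AddCommGroup (E p)] [∀ p, Module ℚ (E p)] [GrLieAlgebra E]

/-- The graded vector space `W` with `W^{p+1}` the continuous dual of `E_p`. -/
def cochainSpace : ℕ → Type u
  | 0 => PUnit
  | p + 1 => continuousDual E p

instance : ∀ p, AddCommGroup (cochainSpace E p)
  | 0 => (inferInstance : AddCommGroup PUnit.{u + 1})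
  | p + 1 => (inferInstance : AddCommGroup (continuousDual E p))

instance : ∀ p, Module ℚ (cochainSpace E p)
  | 0 => (inferInstance : Module ℚ PUnit.{u + 1})
  | p + 1 => (inferInstance : Module ℚ (continuousDual E p))

instance : Subsingleton (cochainSpace E 0) := inferInstanceAs (Subsingleton PUnit)

variable {E}

/-- The suspension isomorphism `E_p ≅ (W^{p+1})^∨`. -/
def suspension (hpro : IsPronilpotent E) (hfin : AbelianizationFiniteType E) (p : ℕ) :
    E p ≃ₗ[ℚ] Module.Dual ℚ (cochainSpace E (p + 1)) :=
  evaluationEquiv hpro hfin p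

theorem isContinuousDual_suspension (hpro : IsPronilpotent E) (hfin : AbelianizationFiniteType E) :
    IsContinuousDual (suspension hpro hfin) where
  exists_annihilates {p} v := by
    obtain ⟨w, n, hn⟩ := (show continuousDual E p from v)
    exact ⟨n, (Submodule.mem_dualAnnihilator _).1 hn⟩
  exists_eq {n p} f hf := ⟨(⟨f, n, hf⟩ : continuousDual E p), fun x => rfl⟩

end CochainSpace

end GrLieAlgebra

/-! ### Degrees of contractions, and functoriality in the generators -/

namespace FreeCGA

section Degree

variable {V : ℕ → Type u} [∀ p, AddCommGroup (V p)] [∀ p, Module ℚ (V p)]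

/-- Two clauses avoid the truncated difference `n - p`: below degree `p` the contraction is zero
rather than of degree 0. -/
theorem contraction_degree {p n : ℕ} (f : Module.Dual ℚ (V p)) {a : FreeCGA V}
    (ha : a ∈ degree V n) :
    (∀ m, n = m + p → contraction f a ∈ degree V m) ∧ (n < p → contraction f a = 0) := by
  refine degree_induction (C := fun n a => (∀ m, n = m + p → contraction f a ∈ degree V m) ∧
    (n < p → contraction f a = 0)) ?_ ?_ ?_ ?_ ?_ ha
  · rw [(isDerivation_contraction f).map_one]
    exact ⟨fun _ _ => zero_mem _, fun _ => rfl⟩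
  · intro n
    rw [map_zero]
    exact ⟨fun _ _ => zero_mem _, fun _ => rfl⟩
  · intro n a b ha hb
    rw [map_add]
    exact ⟨fun m h => add_mem (ha.1 m h) (hb.1 m h), fun h => by rw [ha.2 h, hb.2 h, add_zero]⟩
  · intro n c a ha
    rw [map_smul]
    exact ⟨fun m h => Submodule.smul_mem _ c (ha.1 m h), fun h => by rw [ha.2 h, smul_zero]⟩
  · intro i n v a ha h
    have e := contraction_ι_mul f (DirectSum.lof ℚ ℕ V i v) a
    rw [ι_lof, sgn_gen, smul_mul_assoc] at e
    rw [e]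
    refine ⟨fun m hm => add_mem ?_ (Submodule.smul_mem _ _ ?_), fun hlt => ?_⟩
    · by_cases hi : i = p
      · obtain rfl : n = m := by omega
        exact Submodule.smul_mem _ _ ha
      · rw [lof_apply_of_ne v hi, map_zero, zero_smul]
        exact zero_mem _
    · rcases lt_or_ge n p with hn | hn
      · rw [h.2 hn, mul_zero]
        exact zero_mem _
      · obtain ⟨l, rfl⟩ := Nat.exists_eq_add_of_le' hn
        obtain rfl : i + l = m := by omega
        exact mul_mem_degree (gen_mem_degree i v) (h.1 l rfl)
    · rw [lof_apply_of_ne v (by omega), h.2 (by omega), map_zero, zero_smul, mul_zero, smul_zero,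
        add_zero]

theorem eq_zero_of_algebraMap_mem_degree {n : ℕ} (hn : n ≠ 0) {c : ℚ}
    (hc : algebraMap ℚ (FreeCGA V) c ∈ degree V n) : c = 0 := by
  let F : FreeCGA V →ₐ[ℚ] ℚ := lift 0 (by simp)
  have hF : ∀ i (v : V i), F (gen V i v) = 0 := fun i v => lift_ι _ _ _
  have key := degree_induction (C := fun n a => n ≠ 0 → F a = 0) (fun h => absurd rfl h)
    (fun n _ => map_zero F) (fun n a b ha hb h => by rw [map_add, ha h, hb h, add_zero])
    (fun n c a ha h => by rw [map_smul, ha h, smul_zero])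
    (fun i n v a _ _ _ => by rw [map_mul, hF, zero_mul]) hc hn
  rwa [AlgHom.commutes] at key

/-- The double contraction is a scalar, and it is either zero for lack of degree or homogeneous of
degree `n - p - q ≠ 0`. -/
theorem pairing_eq_zero_of_degree {p q n : ℕ} (f : Module.Dual ℚ (V p)) (g : Module.Dual ℚ (V q))
    {a : FreeCGA V} (hw : a ∈ wedge V 2) (ha : a ∈ degree V n) (hn : n ≠ p + q) :
    pairing f g a = 0 := by
  refine algebraMap_injective (V := V) ?_
  rw [← contraction_contraction f g hw, map_zero]
  rcases lt_or_ge n q with h | h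
  · rw [(contraction_degree g ha).2 h, map_zero]
  obtain ⟨l, rfl⟩ := Nat.exists_eq_add_of_le' h
  have hl := (contraction_degree g ha).1 l rfl
  rcases lt_or_ge l p with h | h
  · rw [(contraction_degree f hl).2 h]
  obtain ⟨m, rfl⟩ := Nat.exists_eq_add_of_le' h
  have hm := (contraction_degree f hl).1 m rfl
  rw [contraction_contraction f g hw] at hm ⊢
  rw [eq_zero_of_algebraMap_mem_degree (by omega) hm, map_zero]

/-- A derivation that kills generators kills the subalgebra they generate. Applied to `ΛV(n)`, this
drives the comparison of the two filtrations. -/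
theorem contraction_eq_zero_of_mem_adjoin {p : ℕ} (f : Module.Dual ℚ (V p)) {S : Set (⨁ p, V p)}
    (hS : ∀ x ∈ S, f (x p) = 0) {a : FreeCGA V} (ha : a ∈ Algebra.adjoin ℚ (ι V '' S)) :
    contraction f a = 0 := by
  induction ha using Algebra.adjoin_induction with
  | mem x hx =>
    obtain ⟨x, hx, rfl⟩ := hx
    rw [contraction_ι, hS x hx, map_zero]
  | algebraMap r => exact contraction_algebraMap f r
  | add a b _ _ ha hb => rw [map_add, ha, hb, add_zero]
  | mul a b _ _ ha hb => rw [(isDerivation_contraction f).map_mul, ha, hb, zero_mul, mul_zero,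
      add_zero]

end Degree

section Functoriality

variable {V : ℕ → Type u} [∀ p, AddCommGroup (V p)] [∀ p, Module ℚ (V p)]
  {W : ℕ → Type v} [∀ p, AddCommGroup (W p)] [∀ p, Module ℚ (W p)]

/-- The linear map `⨁ V^p → ⨁ W^p` induced by a graded linear map. -/
def directSumMap (φ : ∀ p, V p →ₗ[ℚ] W p) : (⨁ p, V p) →ₗ[ℚ] ⨁ p, W p :=
  DirectSum.toModule ℚ ℕ _ fun i => DirectSum.lof ℚ ℕ W i ∘ₗ φ i

theorem directSumMap_lof (φ : ∀ p, V p →ₗ[ℚ] W p) (i : ℕ) (v : V i) :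
    directSumMap φ (DirectSum.lof ℚ ℕ V i v) = DirectSum.lof ℚ ℕ W i (φ i v) := by
  simp [directSumMap, DirectSum.toModule_lof]

theorem directSumMap_apply (φ : ∀ p, V p →ₗ[ℚ] W p) (x : ⨁ p, V p) (i : ℕ) :
    directSumMap φ x i = φ i (x i) := by
  induction x using DirectSum.induction_on with
  | zero => simp
  | of j v =>
    change directSumMap φ (DirectSum.lof ℚ ℕ V j v) i = φ i (DirectSum.lof ℚ ℕ V j v i)
    rw [directSumMap_lof]
    by_cases h : j = i
    · subst h
      rw [lof_apply_self, lof_apply_self]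
    · rw [lof_apply_of_ne _ h, lof_apply_of_ne _ h, map_zero]
  | add x y hx hy => rw [map_add, DirectSum.add_apply, hx, hy, DirectSum.add_apply, map_add]

/-- The algebra homomorphism `ΛV → ΛW` induced by a graded linear map `V → W`. -/
def map (φ : ∀ p, V p →ₗ[ℚ] W p) : FreeCGA V →ₐ[ℚ] FreeCGA W :=
  lift (ι W ∘ₗ directSumMap φ) fun i j v w => by
    simp only [LinearMap.comp_apply, directSumMap_lof]
    exact gen_mul_gen i j _ _

theorem map_ι (φ : ∀ p, V p →ₗ[ℚ] W p) (x : ⨁ p, V p) : map φ (ι V x) = ι W (directSumMap φ x) :=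
  lift_ι _ _ _

theorem map_gen (φ : ∀ p, V p →ₗ[ℚ] W p) (i : ℕ) (v : V i) :
    map φ (gen V i v) = gen W i (φ i v) := by
  rw [← ι_lof, map_ι, directSumMap_lof, ι_lof]

theorem map_mem_degree (φ : ∀ p, V p →ₗ[ℚ] W p) {n : ℕ} {a : FreeCGA V} (ha : a ∈ degree V n) :
    map φ a ∈ degree W n := by
  refine degree_induction (C := fun n a => map φ a ∈ degree W n) ?_ ?_ ?_ ?_ ?_ ha
  · rw [map_one]
    exact one_mem_degree
  · intro n
    rw [map_zero]
    exact zero_mem _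
  · intro n a b ha hb
    rw [map_add]
    exact add_mem ha hb
  · intro n c a ha
    rw [map_smul]
    exact Submodule.smul_mem _ c ha
  · intro i n v a _ h
    rw [map_mul, map_gen]
    exact mul_mem_degree (gen_mem_degree i _) h

theorem map_mem_wedge_two (φ : ∀ p, V p →ₗ[ℚ] W p) {a : FreeCGA V} (ha : a ∈ wedge V 2) :
    map φ a ∈ wedge W 2 := by
  refine wedge_two_induction (C := fun a => map φ a ∈ wedge W 2) (fun x y => ?_)
    (fun a b ha hb => ?_) ha
  · rw [map_mul, map_ι, map_ι]
    exact mul_mem_wedge (ι_mem_wedge _) (ι_mem_wedge _)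
  · rw [map_add]
    exact add_mem ha hb

theorem pairing_map (φ : ∀ p, V p →ₗ[ℚ] W p) {p q : ℕ} (f : Module.Dual ℚ (W p))
    (g : Module.Dual ℚ (W q)) {a : FreeCGA V} (ha : a ∈ wedge V 2) :
    pairing f g (map φ a) = pairing (f ∘ₗ φ p) (g ∘ₗ φ q) a := by
  refine wedge_two_induction
    (C := fun a => pairing f g (map φ a) = pairing (f ∘ₗ φ p) (g ∘ₗ φ q) a) (fun x y => ?_)
    (fun a b ha hb => ?_) ha
  · rw [map_mul, map_ι, map_ι, pairing_ι_mul_ι, pairing_ι_mul_ι]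
    simp only [directSumMap_apply, LinearMap.comp_apply]
  · rw [map_add, map_add, ha, hb, map_add]

/-- The algebra isomorphism `ΛV ≅ ΛW` induced by a graded isomorphism `V ≅ W`. -/
def mapEquiv (φ : ∀ p, V p ≃ₗ[ℚ] W p) : FreeCGA V ≃ₐ[ℚ] FreeCGA W :=
  AlgEquiv.ofAlgHom (map fun p => (φ p).toLinearMap) (map fun p => (φ p).symm.toLinearMap)
    (algHom_ext fun i v => by simp [map_gen]) (algHom_ext fun i v => by simp [map_gen])

theorem mapEquiv_apply (φ : ∀ p, V p ≃ₗ[ℚ] W p) (a : FreeCGA V) :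
    mapEquiv φ a = map (fun p => (φ p).toLinearMap) a := rfl

theorem map_degree_mapEquiv (φ : ∀ p, V p ≃ₗ[ℚ] W p) (n : ℕ) :
    (degree V n).map (mapEquiv φ).toLinearMap = degree W n := by
  refine le_antisymm ?_ fun a ha => ⟨(mapEquiv φ).symm a, map_mem_degree _ ha,
    (mapEquiv φ).apply_symm_apply a⟩
  rintro _ ⟨a, ha, rfl⟩
  exact map_mem_degree _ ha

theorem map_range_mapEquiv (φ : ∀ p, V p ≃ₗ[ℚ] W p) :
    (LinearMap.range (ι V)).map (mapEquiv φ).toLinearMap = LinearMap.range (ι W) := by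
  refine le_antisymm ?_ ?_
  · rintro _ ⟨_, ⟨x, rfl⟩, rfl⟩
    exact ⟨_, (map_ι _ x).symm⟩
  · rintro _ ⟨x, rfl⟩
    exact ⟨(mapEquiv φ).symm (ι W x), ⟨_, (map_ι _ x).symm⟩, (mapEquiv φ).apply_symm_apply _⟩

end Functoriality

end FreeCGA

/-! ### Uniqueness of the quadratic Sullivan algebra -/

namespace LambdaAlgebra

open FreeCGA GrLieAlgebra

variable {E : ℕ → Type w} [∀ p, AddCommGroup (E p)] [∀ p, Module ℚ (E p)] [GrLieAlgebra E]

/-- The suspension `s` exhibits `E` as the homotopy Lie algebra of `A`. -/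
def IsSuspension (A : LambdaAlgebra.{u}) (s : ∀ p, E p ≃ₗ[ℚ] Module.Dual ℚ (A.V (p + 1))) : Prop :=
  ∀ (p q r : ℕ) (h : p + q = r) (x : E p) (y : E q) (w : A.V (r + 1)),
    s r (bracket h x y) w = (-1) ^ (q + 1) * pairing (s p x) (s q y) (A.d (gen A.V (r + 1) w))

theorem d_one (A : LambdaAlgebra.{u}) : A.d 1 = 0 := by
  simpa using A.d_mul 0 1 one_mem_degree 1

section

variable {A : LambdaAlgebra.{u}} (hA : A.IsQuadraticSullivan)
  {s : ∀ p, E p ≃ₗ[ℚ] Module.Dual ℚ (A.V (p + 1))} (hs : A.IsSuspension s)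

include hA hs

theorem IsSuspension.pairing_d_ι {p q r : ℕ} (h : p + q = r) (x : E p) (y : E q)
    (v : ⨁ p, A.V p) : pairing (s p x) (s q y) (A.d (ι A.V v)) =
      (-1) ^ (q + 1) * s r (bracket h x y) (v (r + 1)) := by
  have := hA.degree_pos
  induction v using DirectSum.induction_on with
  | zero => simp
  | of i v =>
    change pairing (s p x) (s q y) (A.d (gen A.V i v)) =
      (-1) ^ (q + 1) * s r (bracket h x y) (DirectSum.lof ℚ ℕ A.V i v (r + 1))
    by_cases hi : i = r + 1
    · subst hi
      rw [lof_apply_self, hs p q r h, ← mul_assoc, neg_one_pow_mul_self, one_mul]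
    · rw [lof_apply_of_ne v hi, map_zero, mul_zero]
      exact pairing_eq_zero_of_degree _ _ (hA.quadratic _) (A.d_degree i _ (gen_mem_degree i v))
        (by omega)
  | add v w hv hw =>
    rw [map_add, map_add, map_add, hv, hw, DirectSum.add_apply, map_add, mul_add]

theorem IsSuspension.apply_bracket {p q r : ℕ} (h : p + q = r) (x : E p) (y : E q)
    (v : ⨁ p, A.V p) : s r (bracket h x y) (v (r + 1)) =
      (-1) ^ (q + 1) * pairing (s p x) (s q y) (A.d (ι A.V v)) := by
  rw [hs.pairing_d_ι hA h, ← mul_assoc, neg_one_pow_mul_self, one_mul]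

/-- If `dv ∈ ΛV(n)` and `V(n)` vanishes on `E^{n+2}`, then contraction by `y ∈ E^{n+2}` kills `dv`.
Hence `v [x, y] = 0`, so `v` vanishes on `E^{n+3}`, which such brackets span. No finiteness is
needed. -/
theorem IsSuspension.sullivanFiltration_le (n : ℕ) :
    sullivanFiltration A.V A.d n ≤ annihilator s (n + 2) := by
  have key : ∀ (n : ℕ) (v : ⨁ p, A.V p), (∀ (p q r : ℕ) (h : p + q = r) (x : E p) (y : E q),
      y ∈ lowerCentral E (n + 1) q → s r (bracket h x y) (v (r + 1)) = 0) →
      v ∈ annihilator s (n + 2) := by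
    intro n v hv r z hz
    rw [lowerCentral] at hz
    induction hz using Submodule.span_induction with
    | mem z hz =>
      obtain ⟨p, q, h, x, y, hy, rfl⟩ := hz
      exact hv p q r h x y hy
    | zero => simp
    | add z z' _ _ hz hz' => rw [map_add, LinearMap.add_apply, hz, hz', add_zero]
    | smul c z _ hz => rw [map_smul, LinearMap.smul_apply, hz, smul_zero]
  induction n with
  | zero =>
    intro v hv
    refine key 0 v fun p q r h x y _ => ?_
    rw [sullivanFiltration, LinearMap.mem_ker, LinearMap.comp_apply] at hv
    rw [hs.apply_bracket hA h, hv, map_zero, mul_zero]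
  | succ n ih =>
    intro v hv
    refine key (n + 1) v fun p q r h x y hy => ?_
    rw [sullivanFiltration, Submodule.mem_comap, LinearMap.comp_apply,
      Subalgebra.mem_toSubmodule] at hv
    rw [hs.apply_bracket hA h]
    refine mul_eq_zero_of_right _ (algebraMap_injective (V := A.V) ?_)
    rw [← contraction_contraction _ _ (hA.quadratic v),
      contraction_eq_zero_of_mem_adjoin _ (fun u hu => ih hu q y hy) hv, map_zero, map_zero]

theorem IsSuspension.exists_annihilates {p : ℕ} (v : A.V (p + 1)) :
    ∃ n, ∀ x ∈ lowerCentral E n p, s p x v = 0 := by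
  obtain ⟨n, hn⟩ := A.sullivan (DirectSum.lof ℚ ℕ A.V (p + 1) v)
  refine ⟨n + 2, fun x hx => ?_⟩
  have := hs.sullivanFiltration_le hA n hn p x hx
  rwa [lof_apply_self] at this

end

section Uniqueness

variable {A : LambdaAlgebra.{u}} (hA : A.IsQuadraticSullivan)
  {s : ∀ p, E p ≃ₗ[ℚ] Module.Dual ℚ (A.V (p + 1))} (hs : A.IsSuspension s)
  {B : LambdaAlgebra.{v}} (hB : B.IsQuadraticSullivan)
  {t : ∀ p, E p ≃ₗ[ℚ] Module.Dual ℚ (B.V (p + 1))} (ht : B.IsSuspension t)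

omit [GrLieAlgebra E] in
/-- A vector is determined by its pairings with a suspension. -/
theorem suspension_flip_injective {V : ℕ → Type*} [∀ p, AddCommGroup (V p)]
    [∀ p, Module ℚ (V p)] (s : ∀ p, E p ≃ₗ[ℚ] Module.Dual ℚ (V (p + 1))) (p : ℕ) :
    Function.Injective (s p).toLinearMap.flip := by
  rw [injective_iff_map_eq_zero]
  intro v hv
  refine (Module.forall_dual_apply_eq_zero_iff ℚ v).1 fun f => ?_
  obtain ⟨x, rfl⟩ := (s p).surjective f
  exact LinearMap.congr_fun hv x

-- Through `s` and `t`, both generating spaces embed into the functionals on `E_p`. The image of `A`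
-- consists of continuous functionals, all of which occur in the image of `B`; `φ` is the resulting
-- inclusion.
include hA hs in
theorem exists_generator_equiv (hc : IsContinuousDual t) (p : ℕ) :
    ∃ φ : A.V (p + 1) ≃ₗ[ℚ] B.V (p + 1), ∀ x v, t p x (φ v) = s p x v := by
  have hle : ∀ v, (s p).toLinearMap.flip v ∈ LinearMap.range (t p).toLinearMap.flip := by
    intro v
    obtain ⟨n, hn⟩ := hs.exists_annihilates hA v
    obtain ⟨w, hw⟩ := hc.exists_eq ((s p).toLinearMap.flip v)
      ((Submodule.mem_dualAnnihilator _).2 hn)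
    exact ⟨w, LinearMap.ext hw⟩
  let e := LinearEquiv.ofInjective (t p).toLinearMap.flip (suspension_flip_injective t p)
  let φ : A.V (p + 1) →ₗ[ℚ] B.V (p + 1) :=
    e.symm.toLinearMap ∘ₗ LinearMap.codRestrict _ (s p).toLinearMap.flip hle
  have hφ : ∀ x v, t p x (φ v) = s p x v := fun x v =>
    LinearMap.congr_fun (congrArg Subtype.val (e.apply_symm_apply ⟨_, hle v⟩)) x
  have hinj : Function.Injective φ := by
    intro v v' h
    refine suspension_flip_injective s p (LinearMap.ext fun x => ?_)
    have := congrArg (t p x) h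
    rwa [hφ, hφ] at this
  have hsurj : Function.Surjective φ := by
    rw [← LinearMap.range_eq_top]
    by_contra hne
    -- A nonzero functional vanishing on the image of `φ` is `t p x` for some `x`; then `s p x = 0`,
    -- so `x = 0` and the functional was zero.
    obtain ⟨f, hf, hle⟩ := Submodule.exists_le_ker_of_lt_top _ (lt_top_iff_ne_top.2 hne)
    obtain ⟨x, rfl⟩ := (t p).surjective f
    refine hf ?_
    have : s p x = 0 := LinearMap.ext fun v => by
      rw [← hφ]
      exact hle ⟨v, rfl⟩
    rw [(s p).map_eq_zero_iff.1 this, map_zero]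
  exact ⟨LinearEquiv.ofBijective φ ⟨hinj, hsurj⟩, hφ⟩

include hA hs hB ht in
theorem isomorphic_of_isContinuousDual (hc : IsContinuousDual t) : Isomorphic A B := by
  have hA0 := hA.degree_pos
  have hB0 := hB.degree_pos
  have hφ : ∃ φ : ∀ p, A.V p ≃ₗ[ℚ] B.V p, ∀ p x v, t p x (φ (p + 1) v) = s p x v := by
    choose φ hφ using exists_generator_equiv hA hs hc
    -- In degree 0 both spaces are trivial, so the zero map is an equivalence.
    exact ⟨fun | 0 => 0 | p + 1 => φ p, hφ⟩
  obtain ⟨φ, hφ⟩ := hφ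
  refine ⟨mapEquiv φ, map_degree_mapEquiv φ, map_range_mapEquiv φ, fun a => ?_⟩
  -- Both sides lie in `Λ²`, and both double contractions evaluate the same functional on the same
  -- bracket of `E`.
  have hι : ∀ v, mapEquiv φ (A.d (ι A.V v)) = B.d (mapEquiv φ (ι A.V v)) := by
    intro v
    have hw : mapEquiv φ (A.d (ι A.V v)) ∈ wedge B.V 2 := map_mem_wedge_two _ (hA.quadratic v)
    have hw' : B.d (mapEquiv φ (ι A.V v)) ∈ wedge B.V 2 := by
      rw [mapEquiv_apply, map_ι]
      exact hB.quadratic _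
    have hsub := sub_mem_wedge hw hw'
    rw [← sub_eq_zero]
    refine eq_zero_of_suspension t hsub fun q y => ?_
    refine eq_zero_of_suspension t (contraction_mem_wedge _ hsub) fun p x => ?_
    rw [map_sub, map_sub, contraction_contraction _ _ hw, contraction_contraction _ _ hw',
      sub_eq_zero, mapEquiv_apply, mapEquiv_apply, map_ι, pairing_map _ _ _ (hA.quadratic v),
      ht.pairing_d_ι hB rfl, directSumMap_apply]
    have e : ∀ p (x : E p), (t p x) ∘ₗ (φ (p + 1)).toLinearMap = s p x := fun p x =>
      LinearMap.ext (hφ p x)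
    rw [e, e, hs.pairing_d_ι hA rfl]
    exact congrArg _ (congrArg _ (hφ _ _ _).symm)
  induction a using gen_mul_induction with
  | one => rw [d_one, map_zero, map_one, d_one]
  | add a b ha hb => rw [map_add, map_add, ha, hb, map_add, map_add]
  | smul c a ha => rw [map_smul, map_smul, ha, map_smul, map_smul]
  | gen_mul i v a ha =>
    have h1 := hι (DirectSum.lof ℚ ℕ A.V i v)
    rw [ι_lof] at h1
    have h2 : mapEquiv φ (gen A.V i v) ∈ degree B.V i := map_mem_degree _ (gen_mem_degree i v)
    rw [A.d_mul i _ (gen_mem_degree i v), map_add, map_smul, map_mul, map_mul, ha, h1, map_mul,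
      B.d_mul i _ h2]

end Uniqueness

end LambdaAlgebra

end

theorem proposition5 (E : ℕ → Type u) [∀ p, AddCommGroup (E p)] [∀ p, Module ℚ (E p)]
    [GrLieAlgebra E] (hpro : GrLieAlgebra.IsPronilpotent E)
    (hfin : GrLieAlgebra.AbelianizationFiniteType E) :
    ∃ W : LambdaAlgebra.{u},
      W.IsQuadraticSullivan ∧ LambdaAlgebra.IsHomotopyLieAlgebra E W ∧
      ∀ V : LambdaAlgebra.{v},
        V.IsQuadraticSullivan → LambdaAlgebra.IsHomotopyLieAlgebra E V →
          LambdaAlgebra.Isomorphic V W := by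
  have hc := GrLieAlgebra.isContinuousDual_suspension hpro hfin
  have hq := GrLieAlgebra.isQuadraticSullivan_cochainAlgebra hc hfin
  have ht : (GrLieAlgebra.cochainAlgebra hc hfin).IsSuspension
      (GrLieAlgebra.suspension hpro hfin) := fun p q r h x y w =>
    GrLieAlgebra.suspension_bracket_cochainAlgebra hc hfin h x y w
  refine ⟨GrLieAlgebra.cochainAlgebra hc hfin, hq, ⟨_, ht⟩, ?_⟩
  rintro V hV ⟨s, hs⟩
  exact LambdaAlgebra.isomorphic_of_isContinuousDual hV hs hq ht hc
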